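/- Let $\mathcal X,\mathcal Y$ be real Hilbert spaces, $K:\mathcal X\to\mathcal Y$ a compact, injective, bounded linear operator with dense range, and $\hat y\in\mathcal D(K^+)$, where $A^+$ denotes the generalised (Moore–Penrose) inverse of $A$: $A^+f$ is the least-squares solution of $Ax=f$ of minimal norm, and $\mathcal D(A^+)$ is the set of those $f$ for which a least-squares solution exists. *Discretisation.* Let $l_j=(\eta_j,\cdot)_{\mathcal Y}$, $j\in\mathbb N$, be bounded linear functionals on $\mathcal Y$ with $\|l_1\|=\|l_2\|=\dots$ that are complete (for every $y\ne0$ there is a $j$ with $l_j(y)\neq0$) and well-conditioned: there is a $c<1$ with $\sum_{i\ne j}|(\eta_i,\eta_j)|/\|\eta_1\|^2\le c$ for all $j$. Put $P_my=(l_1(y),\dots,l_m(y))^T\in\mathbb R^m$ (Euclidean norm). *Measurements.* Let $Y_{ij}=l_j(\hat y)+\delta_{ij}$, where $(\delta_{ij})_{i,j\in\mathbb N}$ are independent and identically distributed real random variables with zero mean and finite variance. Let $$\bar Y^{(m)}_n=\Big(\tfrac1n\sum_{i=1}^nY_{ij}\Big)_{j=1}^m,\qquad s_{m,n}^2=\frac1m\sum_{j=1}^m\frac1{n-1}\sum_{i=1}^n\Big(Y_{ij}-\tfrac1n\sum_{k=1}^nY_{kj}\Big)^2\quad(n\ge2).$$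 *Known bounds.* Let $(\delta^{disc}_m)$ and $(c_m)$ be sequences of reals with $\delta_m^{disc}\to0$ such that, for all $m$ large enough, $\delta_m^{disc}>0$, $\|\hat y-P_m^+P_m\hat y\|\le\delta_m^{disc}$, and $c_m>0$ is a lower bound for all (positive) singular values of $P_m$. *Method.* Fix $\tau>1$ and $q\in(0,1)$. Let $n_m=\min\{n\ge2: m s_{m,n}^2/(n c_m^2)\le(\delta_m^{disc})^2\}$ and $Z_m=P_m^+\bar Y^{(m)}_{n_m}$. For $\alpha>0$ and $z\in\mathcal Y$ let $R_\alpha z$ be the minimiser of $\|Kx-z\|^2+\alpha\|x\|^2$ over $x\in\mathcal X$. Let $\alpha_m=q^{k}$ with the smallest $k\in\{0,1,2,\dots\}$ such that $\|KR_{q^k}Z_m-Z_m\|\le2\tau\delta_m^{disc}$. Then, for all $m$ large enough, $n_m$ and $\alpha_m$ are well defined almost surely, and $$\lim_{m\to\infty}\mathbb P\big(\|R_{\alpha_m}Z_m-K^+\hat y\|\ge\varepsilon\big)=0\qquad\text{for all }\varepsilon>0.$$ If moreover there are $0<\nu\le1$ and $\rho>0$ such that $K^+\hat y=(K^*K)^{\nu/2}w$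 for some $w\in\mathcal X$ with $\|w\|\le\rho$, then $$\lim_{m\to\infty}\mathbb P\Big(\|R_{\alpha_m}Z_m-K^+\hat y\|\le L'\,\rho^{\frac1{\nu+1}}(\delta_m^{disc})^{\frac{\nu}{\nu+1}}\Big)=1$$ with a constant $L'$ that depends only on $\nu$, $\tau$ and $q$. -/

import Mathlib

open Filter Topology MeasureTheory ProbabilityTheory
open scoped ENNReal

noncomputable section

namespace InvProb

section Operators

variable {E F : Type*} [NormedAddCommGroup E] [InnerProductSpace ℝ E] [CompleteSpace E]
  [NormedAddCommGroup F] [InnerProductSpace ℝ F] [CompleteSpace F]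

/-- `x` is a least-squares solution of `A x = f`. -/
def IsLeastSquares (A : E →L[ℝ] F) (f : F) (x : E) : Prop :=
  ∀ x' : E, ‖A x - f‖ ≤ ‖A x' - f‖

/-- `x` is a least-squares solution of `A x = f` of minimal norm. -/
def IsMinNormLeastSquares (A : E →L[ℝ] F) (f : F) (x : E) : Prop :=
  IsLeastSquares A f x ∧ ∀ x' : E, IsLeastSquares A f x' → ‖x‖ ≤ ‖x'‖

/-- The domain `D(A⁺)` of the generalised (Moore-Penrose) inverse: those right hand sides for
which a least-squares solution exists. -/
def pinvDomain (A : E →L[ℝ] F) : Set F :=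
  {f | ∃ x : E, IsLeastSquares A f x}

open Classical in
/-- The generalised (Moore-Penrose) inverse `A⁺`: on `D(A⁺)` it is the (unique) least-squares
solution of minimal norm; off `D(A⁺)` it is given the value `0`. -/
def pinv (A : E →L[ℝ] F) (f : F) : E :=
  if h : ∃ x : E, IsMinNormLeastSquares A f x then h.choose else 0

/-- `x` minimises the Tikhonov functional `‖A x - z‖² + α ‖x‖²`. -/
def IsTikhonovMinimiser (A : E →L[ℝ] F) (α : ℝ) (z : F) (x : E) : Prop :=
  ∀ x' : E, ‖A x - z‖ ^ 2 + α * ‖x‖ ^ 2 ≤ ‖A x' - z‖ ^ 2 + α * ‖x'‖ ^ 2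

open Classical in
/-- The Tikhonov regularisation `R_α z`: the (for `α > 0` existing and unique) minimiser of the
Tikhonov functional. -/
def tikhonov (A : E →L[ℝ] F) (α : ℝ) (z : F) : E :=
  if h : ∃ x : E, IsTikhonovMinimiser A α z x then h.choose else 0

/-- `σ` is a (positive) singular value of `A`: `σ > 0` and `σ²` is an eigenvalue of `A A*`. -/
def IsSingularValue (A : E →L[ℝ] F) (σ : ℝ) : Prop :=
  0 < σ ∧ Module.End.HasEigenvalue ((A ∘L A.adjoint : F →L[ℝ] F) : F →ₗ[ℝ] F) (σ ^ 2)

/-- The power `T ^ s` (with `s > 0`) of a compact positive self-adjoint operator `T`, through its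
spectral decomposition: `T ^ s w = ∑ λ ^ s • (orthogonal projection of w onto ker (T - λ))`, the
sum running over the eigenvalues `λ` (all other summands vanish). -/
def spectralPower (T : E →L[ℝ] E) (s : ℝ) (w : E) : E :=
  ∑' lam : ℝ,
    lam ^ s • (Module.End.eigenspace (T : E →ₗ[ℝ] E) lam).starProjection w

end Operators

section Discretisation

variable {Y : Type*} [NormedAddCommGroup Y] [InnerProductSpace ℝ Y] [CompleteSpace Y]

/-- The discretisation operator `P_m y = (l_1 y, …, l_m y)` into Euclidean space; the channels are
numbered from `0`. -/
def discOp (l : ℕ → Y →L[ℝ] ℝ) (m : ℕ) : Y →L[ℝ] EuclideanSpace ℝ (Fin m) :=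
  ((EuclideanSpace.equiv (Fin m) ℝ).symm : (Fin m → ℝ) →L[ℝ] EuclideanSpace ℝ (Fin m)) ∘L
    ContinuousLinearMap.pi fun j : Fin m => l j

/-- The Riesz representer `η` of a functional, `f y = ⟪η, y⟫`. -/
def riesz (f : Y →L[ℝ] ℝ) : Y := (InnerProductSpace.toDual ℝ Y).symm f

/-- Completeness of the sequence of functionals. -/
def IsCompleteFamily (l : ℕ → Y →L[ℝ] ℝ) : Prop :=
  ∀ y : Y, y ≠ 0 → ∃ j, l j y ≠ 0

/-- Well-conditionedness: `sup_j ∑_{i ≠ j} |⟪η_i, η_j⟫| / ‖η_1‖² ≤ c < 1` for some `c`. -/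
def IsWellConditioned (l : ℕ → Y →L[ℝ] ℝ) : Prop :=
  ∃ c : ℝ, c < 1 ∧ ∀ j : ℕ,
    Summable (fun i : {i : ℕ // i ≠ j} =>
      |inner ℝ (riesz (l i)) (riesz (l j))| / ‖riesz (l 0)‖ ^ 2) ∧
    ∑' i : {i : ℕ // i ≠ j},
      |inner ℝ (riesz (l i)) (riesz (l j))| / ‖riesz (l 0)‖ ^ 2 ≤ c

end Discretisation

section Algorithm

/- Throughout, `D i j` is the `i`-th sample on the `j`-th channel. -/

/-- The channel-wise mean of the first `n` samples on the first `m` channels. -/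
def sampleMean (D : ℕ → ℕ → ℝ) (m n : ℕ) : EuclideanSpace ℝ (Fin m) :=
  WithLp.toLp 2 fun j : Fin m => (∑ i ∈ Finset.range n, D i j) / n

/-- The mean over the first `m` channels of the sample variances of the first `n` samples. -/
def sampleVar (D : ℕ → ℕ → ℝ) (m n : ℕ) : ℝ :=
  (∑ j ∈ Finset.range m,
    (∑ i ∈ Finset.range n, (D i j - (∑ k ∈ Finset.range n, D k j) / n) ^ 2) / ((n : ℝ) - 1)) / m

/-- The numbers `n ≥ 2` of repetitions with `m s²_{m,n} / (n c²) ≤ d²`. -/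
def admissibleRepetitions (D : ℕ → ℕ → ℝ) (m : ℕ) (c d : ℝ) : Set ℕ :=
  {n | 2 ≤ n ∧ m * sampleVar D m n / (n * c ^ 2) ≤ d ^ 2}

/-- The number of repetitions `n(m, d)`. -/
def repetitions (D : ℕ → ℕ → ℝ) (m : ℕ) (c d : ℝ) : ℕ :=
  sInf (admissibleRepetitions D m c d)

variable {X Y : Type*} [NormedAddCommGroup X] [InnerProductSpace ℝ X] [CompleteSpace X]
  [NormedAddCommGroup Y] [InnerProductSpace ℝ Y] [CompleteSpace Y]

/-- The back-projected measurement `Z = P_m⁺ Ȳ` with `n(m, d)` repetitions. -/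
def backProjection (l : ℕ → Y →L[ℝ] ℝ) (D : ℕ → ℕ → ℝ) (m : ℕ) (c d : ℝ) : Y :=
  pinv (discOp l m) (sampleMean D m (repetitions D m c d))

/-- The indices `k` for which `α = q ^ k` meets the discrepancy principle
`‖K R_α z - z‖ ≤ 2 τ d`. -/
def admissibleIndices (K : X →L[ℝ] Y) (z : Y) (τ q d : ℝ) : Set ℕ :=
  {k | ‖K (tikhonov K (q ^ k) z) - z‖ ≤ 2 * τ * d}

/-- The regularisation parameter `α = q ^ k` with the first `k = 0, 1, 2, …` that meets the
discrepancy principle. -/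
def discrepancyParameter (K : X →L[ℝ] Y) (z : Y) (τ q d : ℝ) : ℝ :=
  q ^ sInf (admissibleIndices K z τ q d)

/-- The reconstruction `R_α Z` produced from the measurements `D` by the approach with
infinite-dimensional residuum and the discrepancy principle. -/
def idrReconstruction (K : X →L[ℝ] Y) (l : ℕ → Y →L[ℝ] ℝ) (D : ℕ → ℕ → ℝ) (m : ℕ)
    (c d τ q : ℝ) : X :=
  tikhonov K (discrepancyParameter K (backProjection l D m c d) τ q d)
    (backProjection l D m c d)

/-- Both searches of the method succeed: a number of repetitions and a regularisation parameter
are found. -/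
def Terminates (K : X →L[ℝ] Y) (l : ℕ → Y →L[ℝ] ℝ) (D : ℕ → ℕ → ℝ) (m : ℕ)
    (c d τ q : ℝ) : Prop :=
  (admissibleRepetitions D m c d).Nonempty ∧
    (admissibleIndices K (backProjection l D m c d) τ q d).Nonempty

end Algorithm

end InvProb

end

set_option linter.unusedSectionVars false

/-! Let `x = K⁺ŷ`, `d = δ_m^disc`, `κ = (c_m d)²`. The proof has a deterministic and a probabilistic
half, which meet in the bound `‖Z - K x‖ ≤ (1 + τ) d`.

Deterministic half. The Tikhonov residual map is a contraction, so the data error contributes at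
most `(1 + τ) d` to the residual, which is below the threshold `2 τ d`. Hence the residual of the
exact data is at most `(3τ + 1) d` at the chosen `α`, and more than `(τ - 1) d` at the preceding
candidate (`discrepancyParameter_spec`). The upper bound controls the approximation error. The lower
bound keeps `α` from being too small and so controls the propagated data error of size `d / √α`.
Density of the range of `K*` then gives convergence. Under the source condition, a qualification
estimate and an interpolation estimate, checked on finite spectral sums, give the rate.

Probabilistic half. Since `P_m⁺` is bounded by `1 / c_m`, it suffices that the averaged error has
norm at most `τ c_m d`, although the number `n` of repetitions is random. Let `S_j` be the error sum
on channel `j`, `Q` the sum of all squared errors, `M = ∑ S_j² - Q` (a martingale in `n`) and `W`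
the pooled sum of squared deviations. Then `n W = (n - 1) Q - M`, so `(n - 1) ∑ S_j² = n (W + M)`.
The stopping rule says `W ≤ κ n (n - 1)`, so only `M ≤ (τ² - 1) κ n (n - 1)` is missing. Averaging
over channels provides it: `M` is of order `√m n`, while `W` is of order `m n`. Independence makes
second moments of the errors suffice for the variance of `M`, and truncated squares suffice for a
lower bound on `W`. Markov's inequality bounds `n` from above, Doob's inequality controls `M` up to
that bound, and `noise_le_of_good` combines the estimates. -/

namespace InvProb

/-! ### The generalised inverse: normal equation, additivity, norm bound. -/

section GeneralisedInverse

variable {E F : Type*} [NormedAddCommGroup E] [InnerProductSpace ℝ E] [CompleteSpace E]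
  [NormedAddCommGroup F] [InnerProductSpace ℝ F] [CompleteSpace F]

/-- The normal equation says that the residual is orthogonal to the range of `A`, so this is
Pythagoras. -/
lemma norm_sub_sq_of_normal_equation (A : E →L[ℝ] F) {f : F} {x : E}
    (hx : A.adjoint (A x - f) = 0) (x' : E) :
    ‖A x' - f‖ ^ 2 = ‖A x - f‖ ^ 2 + ‖A (x' - x)‖ ^ 2 := by
  have h : A x' - f = (A x - f) + A (x' - x) := by simp
  have h0 : inner ℝ (A x - f) (A (x' - x)) = 0 := by
    rw [← ContinuousLinearMap.adjoint_inner_left, hx, inner_zero_left]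
  rw [h, norm_add_sq_real, h0]
  ring

lemma isLeastSquares_iff_of_normal_equation (A : E →L[ℝ] F) {f : F} {x : E}
    (hx : A.adjoint (A x - f) = 0) (x' : E) : IsLeastSquares A f x' ↔ A (x' - x) = 0 := by
  constructor
  · intro h
    have h1 := h x
    have h2 := norm_sub_sq_of_normal_equation A hx x'
    have h3 : ‖A (x' - x)‖ ^ 2 ≤ 0 := by
      nlinarith [norm_nonneg (A x' - f), norm_nonneg (A x - f)]
    exact norm_eq_zero.1 (pow_eq_zero_iff two_ne_zero |>.1 (le_antisymm h3 (sq_nonneg _)))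
  · intro h z
    have h2 := norm_sub_sq_of_normal_equation A hx x'
    have h3 := norm_sub_sq_of_normal_equation A hx z
    rw [h, norm_zero] at h2
    refine le_of_sq_le_sq ?_ (norm_nonneg _)
    nlinarith [sq_nonneg ‖A (z - x)‖]

/-- A solution of the normal equation in the range of the adjoint is the value of the generalised
inverse. -/
lemma pinv_eq (A : E →L[ℝ] F) {f : F} (u : F)
    (hu : A.adjoint (A (A.adjoint u) - f) = 0) : pinv A f = A.adjoint u := by
  -- Least-squares solutions differ from `A* u` by an element of `ker A`, which is orthogonal to the
  -- range of `A*`. This Pythagoras identity gives both minimality and uniqueness.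
  have hpyth : ∀ x', IsLeastSquares A f x' →
      ‖x'‖ ^ 2 = ‖A.adjoint u‖ ^ 2 + ‖x' - A.adjoint u‖ ^ 2 := by
    intro x' hx'
    have h0 := (isLeastSquares_iff_of_normal_equation A hu x').1 hx'
    have h1 : inner ℝ (A.adjoint u) (x' - A.adjoint u) = 0 := by
      rw [ContinuousLinearMap.adjoint_inner_left, h0, inner_zero_right]
    have h2 : x' = A.adjoint u + (x' - A.adjoint u) := by simp
    conv_lhs => rw [h2, norm_add_sq_real, h1]
    ring
  have hls : IsLeastSquares A f (A.adjoint u) := by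
    rw [isLeastSquares_iff_of_normal_equation A hu]; simp
  have hex : ∃ x : E, IsMinNormLeastSquares A f x := by
    refine ⟨A.adjoint u, hls, fun x' hx' => ?_⟩
    refine le_of_sq_le_sq ?_ (norm_nonneg _)
    nlinarith [hpyth x' hx', sq_nonneg ‖x' - A.adjoint u‖]
  have h3 : pinv A f = hex.choose := dif_pos hex
  have h4 := hpyth _ hex.choose_spec.1
  have h5 := hex.choose_spec.2 _ hls
  rw [h3]
  have h6 : ‖hex.choose - A.adjoint u‖ ^ 2 ≤ 0 := by
    nlinarith [norm_nonneg hex.choose, norm_nonneg (A.adjoint u)]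
  exact sub_eq_zero.1 (norm_eq_zero.1
    (pow_eq_zero_iff two_ne_zero |>.1 (le_antisymm h6 (sq_nonneg _))))

/-- Dense range makes the infimum of the residual zero, so a least-squares solution solves the
equation exactly; by injectivity it is the only one, hence of minimal norm. -/
lemma map_pinv_of_denseRange (K : E →L[ℝ] F) (hinj : Function.Injective K) (hd : DenseRange K)
    {y : F} (hy : y ∈ pinvDomain K) : K (pinv K y) = y := by
  have key : ∀ x, IsLeastSquares K y x → K x = y := by
    intro x hx
    by_contra hne
    have hpos : 0 < ‖K x - y‖ := norm_pos_iff.2 (sub_ne_zero.2 hne)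
    obtain ⟨x', hx'⟩ := hd.exists_dist_lt y hpos
    rw [dist_comm, dist_eq_norm] at hx'
    exact absurd (hx x') (not_le.2 hx')
  obtain ⟨x, hx⟩ := hy
  have hex : ∃ x : E, IsMinNormLeastSquares K y x :=
    ⟨x, hx, fun x' hx' => by rw [hinj ((key x hx).trans (key x' hx').symm)]⟩
  have h3 : pinv K y = hex.choose := dif_pos hex
  rw [h3]
  exact key _ hex.choose_spec.1

/-- For an operator of finite rank, the generalised inverse is given by a preimage under the
adjoint, and it is bounded by the inverse of the smallest singular value. -/
lemma exists_adjoint_eq_pinv [FiniteDimensional ℝ F] (A : E →L[ℝ] F) {c : ℝ} (hc : 0 < c)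
    (hs : ∀ σ : ℝ, IsSingularValue A σ → c ≤ σ) (f : F) :
    ∃ u : F, A.adjoint (A (A.adjoint u) - f) = 0 ∧ ‖A.adjoint u‖ ≤ ‖f‖ / c := by
  set T : F →ₗ[ℝ] F := ((A ∘L A.adjoint : F →L[ℝ] F) : F →ₗ[ℝ] F) with hT
  have hTapp : ∀ v, T v = A (A.adjoint v) := fun v => rfl
  have hsymm : T.IsSymmetric := by
    intro v w
    rw [hTapp, hTapp, ← ContinuousLinearMap.adjoint_inner_left,
      ← ContinuousLinearMap.adjoint_inner_right]
  set b := hsymm.eigenvectorBasis rfl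
  set ev := hsymm.eigenvalues rfl
  have hbe : ∀ i, T (b i) = ev i • b i := fun i => hsymm.apply_eigenvectorBasis rfl i
  have hnorm : ∀ i, ‖A.adjoint (b i)‖ ^ 2 = ev i := by
    intro i
    rw [← real_inner_self_eq_norm_sq, ContinuousLinearMap.adjoint_inner_left, ← hTapp, hbe,
      inner_smul_right, real_inner_self_eq_norm_sq, b.norm_eq_one]
    simp
  have hnn : ∀ i, 0 ≤ ev i := fun i => hnorm i ▸ sq_nonneg _
  have hge : ∀ i, ev i ≠ 0 → c ^ 2 ≤ ev i := by
    intro i hi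
    have hpos : 0 < ev i := lt_of_le_of_ne (hnn i) (Ne.symm hi)
    have h1 : IsSingularValue A (√(ev i)) := by
      refine ⟨Real.sqrt_pos.2 hpos, ?_⟩
      rw [Real.sq_sqrt hpos.le]
      exact hsymm.hasEigenvalue_eigenvalues rfl i
    have h2 := hs _ h1
    calc c ^ 2 ≤ √(ev i) ^ 2 := by gcongr
      _ = ev i := Real.sq_sqrt hpos.le
  -- Because `0⁻¹ = 0`, this inverts `A A*` on its range and drops the kernel directions. `A*` kills
  -- those anyway, by `hnorm`.
  set u : F := ∑ i, ((ev i)⁻¹ * inner ℝ (b i) f) • b i with hu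
  have hTu : T u = ∑ i, ((ev i)⁻¹ * inner ℝ (b i) f * ev i) • b i := by
    rw [hu, map_sum]
    refine Finset.sum_congr rfl fun i _ => ?_
    rw [map_smul, hbe, smul_smul]
  refine ⟨u, ?_, ?_⟩
  · have h1 : A (A.adjoint u) - f =
        ∑ i, ((ev i)⁻¹ * inner ℝ (b i) f * ev i - inner ℝ (b i) f) • b i := by
      rw [← hTapp, hTu]
      conv_lhs => rw [← b.sum_repr' f]
      simp_rw [sub_smul, Finset.sum_sub_distrib]
      rw [b.sum_repr' f]
    rw [h1, map_sum]
    refine Finset.sum_eq_zero fun i _ => ?_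
    rw [map_smul]
    by_cases hi : ev i = 0
    · have : A.adjoint (b i) = 0 := by
        have := hnorm i
        rw [hi] at this
        exact norm_eq_zero.1 (pow_eq_zero_iff two_ne_zero |>.1 this)
      rw [this, smul_zero]
    · rw [mul_right_comm, inv_mul_cancel₀ hi, one_mul, sub_self, zero_smul]
  · rw [le_div_iff₀ hc]
    refine le_of_sq_le_sq ?_ (norm_nonneg _)
    have h1 : ‖A.adjoint u‖ ^ 2 =
        ∑ i, (ev i)⁻¹ * inner ℝ (b i) f * ((ev i)⁻¹ * inner ℝ (b i) f * ev i) := by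
      rw [← real_inner_self_eq_norm_sq, ContinuousLinearMap.adjoint_inner_left, ← hTapp, hTu, hu,
        b.orthonormal.inner_sum]
      simp
    have h2 : ‖f‖ ^ 2 = ∑ i, (inner ℝ (b i) f) ^ 2 := by
      rw [← b.sum_sq_norm_inner_right f]; simp
    rw [mul_pow, h1, h2, Finset.sum_mul]
    refine Finset.sum_le_sum fun i _ => ?_
    by_cases hi : ev i = 0
    · simp [hi, sq_nonneg]
    · have h3 : (ev i)⁻¹ * inner ℝ (b i) f * ((ev i)⁻¹ * inner ℝ (b i) f * ev i) * c ^ 2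
          = (inner ℝ (b i) f) ^ 2 * (c ^ 2 / ev i) := by
        field_simp
      rw [h3]
      have : c ^ 2 / ev i ≤ 1 := div_le_one_of_le₀ (hge i hi) (hnn i)
      nlinarith [sq_nonneg (inner ℝ (b i) f)]

lemma pinv_add [FiniteDimensional ℝ F] (A : E →L[ℝ] F) {c : ℝ} (hc : 0 < c)
    (hs : ∀ σ : ℝ, IsSingularValue A σ → c ≤ σ) (f g : F) :
    pinv A (f + g) = pinv A f + pinv A g := by
  obtain ⟨u, hu, -⟩ := exists_adjoint_eq_pinv A hc hs f
  obtain ⟨v, hv, -⟩ := exists_adjoint_eq_pinv A hc hs g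
  rw [pinv_eq A u hu, pinv_eq A v hv, pinv_eq A (u + v), map_add]
  have : A (A.adjoint (u + v)) - (f + g) = (A (A.adjoint u) - f) + (A (A.adjoint v) - g) := by
    simp only [map_add]; abel
  rw [this, map_add, hu, hv, add_zero]

lemma norm_pinv_le [FiniteDimensional ℝ F] (A : E →L[ℝ] F) {c : ℝ} (hc : 0 < c)
    (hs : ∀ σ : ℝ, IsSingularValue A σ → c ≤ σ) (f : F) : ‖pinv A f‖ ≤ ‖f‖ / c := by
  obtain ⟨u, hu, h⟩ := exists_adjoint_eq_pinv A hc hs f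
  rwa [pinv_eq A u hu]

end GeneralisedInverse

/-! ### Tikhonov regularisation: normal equation and stability. -/

section Tikhonov

variable {E F : Type*} [NormedAddCommGroup E] [InnerProductSpace ℝ E] [CompleteSpace E]
  [NormedAddCommGroup F] [InnerProductSpace ℝ F] [CompleteSpace F]

/-- Lax–Milgram for the form of `K*K + α`, which is coercive with constant `α`. -/
lemma exists_regularised_normal_equation (K : E →L[ℝ] F) {α : ℝ} (hα : 0 < α) (b : E) :
    ∃ x : E, K.adjoint (K x) + α • x = b := by
  set B : E →L[ℝ] E →L[ℝ] ℝ :=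
    (innerSL ℝ).comp ((K.adjoint ∘L K) + α • ContinuousLinearMap.id ℝ E) with hB
  have hBapp : ∀ u v, B u v = inner ℝ (K.adjoint (K u) + α • u) v := fun u v => rfl
  have hco : IsCoercive B := by
    refine ⟨α, hα, fun u => ?_⟩
    rw [hBapp, inner_add_left, ContinuousLinearMap.adjoint_inner_left, inner_smul_left,
      real_inner_self_eq_norm_sq, real_inner_self_eq_norm_sq]
    simp only [conj_trivial]
    nlinarith [sq_nonneg ‖K u‖]
  set e := hco.continuousLinearEquivOfBilin
  refine ⟨e.symm b, ?_⟩
  refine ext_inner_right ℝ fun v => ?_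
  rw [← hBapp, ← hco.continuousLinearEquivOfBilin_apply]
  congr 1
  exact e.apply_symm_apply b

/-- A quadratic functional expanded about a stationary point has no first-order term. Existence and
uniqueness of the minimiser both follow from this. -/
lemma tikhonov_functional_eq (K : E →L[ℝ] F) {α : ℝ} {z : F} {x : E}
    (hx : K.adjoint (K x) + α • x = K.adjoint z) (x' : E) :
    ‖K x' - z‖ ^ 2 + α * ‖x'‖ ^ 2 =
      (‖K x - z‖ ^ 2 + α * ‖x‖ ^ 2) + (‖K (x' - x)‖ ^ 2 + α * ‖x' - x‖ ^ 2) := by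
  have h1 : K x' - z = (K x - z) + K (x' - x) := by simp
  have h2 : x' = x + (x' - x) := by simp
  have h0 : inner ℝ (K x - z) (K (x' - x)) + α * inner ℝ x (x' - x) = 0 := by
    rw [← ContinuousLinearMap.adjoint_inner_left, ← real_inner_smul_left, ← inner_add_left,
      map_sub, sub_add_eq_add_sub, hx, sub_self, inner_zero_left]
  conv_lhs => rw [h1, norm_add_sq_real]; rw [h2, norm_add_sq_real, ← h2]
  linear_combination 2 * h0

lemma tikhonov_eq (K : E →L[ℝ] F) {α : ℝ} (hα : 0 < α) {z : F} {x : E}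
    (hx : K.adjoint (K x) + α • x = K.adjoint z) : tikhonov K α z = x := by
  have hex : ∃ x : E, IsTikhonovMinimiser K α z x := by
    refine ⟨x, fun x' => ?_⟩
    rw [tikhonov_functional_eq K hx x']
    have := mul_nonneg hα.le (sq_nonneg ‖x' - x‖)
    nlinarith [sq_nonneg ‖K (x' - x)‖]
  have h3 : tikhonov K α z = hex.choose := dif_pos hex
  have h4 := hex.choose_spec x
  rw [tikhonov_functional_eq K hx hex.choose] at h4
  rw [h3]
  have h5 : α * ‖hex.choose - x‖ ^ 2 ≤ 0 := by nlinarith [sq_nonneg ‖K (hex.choose - x)‖]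
  have h6 : ‖hex.choose - x‖ ^ 2 ≤ 0 := by
    by_contra h
    exact absurd h5 (not_le.2 (mul_pos hα (not_le.1 h)))
  exact sub_eq_zero.1 (norm_eq_zero.1
    (pow_eq_zero_iff two_ne_zero |>.1 (le_antisymm h6 (sq_nonneg _))))

lemma tikhonov_normal_equation (K : E →L[ℝ] F) {α : ℝ} (hα : 0 < α) (z : F) :
    K.adjoint (K (tikhonov K α z)) + α • tikhonov K α z = K.adjoint z := by
  obtain ⟨x, hx⟩ := exists_regularised_normal_equation K hα (K.adjoint z)
  rwa [tikhonov_eq K hα hx]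

lemma tikhonov_sub (K : E →L[ℝ] F) {α : ℝ} (hα : 0 < α) (z z' : F) :
    tikhonov K α (z - z') = tikhonov K α z - tikhonov K α z' := by
  refine tikhonov_eq K hα ?_
  rw [map_sub, map_sub, map_sub, smul_sub, ← tikhonov_normal_equation K hα z,
    ← tikhonov_normal_equation K hα z']
  abel

lemma tikhonov_functional_le (K : E →L[ℝ] F) {α : ℝ} (hα : 0 < α) (z : F) (x : E) :
    ‖K (tikhonov K α z) - z‖ ^ 2 + α * ‖tikhonov K α z‖ ^ 2 ≤ ‖K x - z‖ ^ 2 + α * ‖x‖ ^ 2 := by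
  rw [tikhonov_functional_eq K (tikhonov_normal_equation K hα z) x]
  have := mul_nonneg hα.le (sq_nonneg ‖x - tikhonov K α z‖)
  nlinarith [sq_nonneg ‖K (x - tikhonov K α z)‖]

/-- Comparison with the competitor `0`; by linearity this bounds the propagated data error. -/
lemma sqrt_mul_norm_tikhonov_le (K : E →L[ℝ] F) {α : ℝ} (hα : 0 < α) (z : F) :
    √α * ‖tikhonov K α z‖ ≤ ‖z‖ := by
  have h := tikhonov_functional_le K hα z 0
  simp only [map_zero, zero_sub, norm_neg, norm_zero] at h
  refine le_of_sq_le_sq ?_ (norm_nonneg _)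
  rw [mul_pow, Real.sq_sqrt hα.le]
  nlinarith [sq_nonneg ‖K (tikhonov K α z) - z‖]

lemma norm_residual_le (K : E →L[ℝ] F) {α : ℝ} (hα : 0 < α) (z : F) :
    ‖K (tikhonov K α z) - z‖ ≤ ‖z‖ := by
  have h := tikhonov_functional_le K hα z 0
  simp only [map_zero, zero_sub, norm_neg, norm_zero] at h
  refine le_of_sq_le_sq ?_ (norm_nonneg _)
  nlinarith [mul_nonneg hα.le (sq_nonneg ‖tikhonov K α z‖)]

/-- The discrepancy principle is met by all small `α`. -/
lemma admissibleIndices_nonempty (K : E →L[ℝ] F) (hd : DenseRange K) (z : F) {τ q d : ℝ}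
    (hq0 : 0 < q) (hq1 : q < 1) (hτ : 0 < τ) (hdpos : 0 < d) :
    (admissibleIndices K z τ q d).Nonempty := by
  have ht : 0 < 2 * τ * d := by positivity
  obtain ⟨x, hx⟩ := hd.exists_dist_lt z ht
  rw [dist_comm, dist_eq_norm] at hx
  -- The functional at one fixed competitor `x` tends to its residual term as `α → 0`, and it
  -- dominates the squared residual of the minimiser.
  have hlim : Tendsto (fun k : ℕ => ‖K x - z‖ ^ 2 + q ^ k * ‖x‖ ^ 2) atTop
      (𝓝 (‖K x - z‖ ^ 2 + 0 * ‖x‖ ^ 2)) :=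
    ((tendsto_pow_atTop_nhds_zero_of_lt_one hq0.le hq1).mul_const _).const_add _
  have hlt : ‖K x - z‖ ^ 2 + 0 * ‖x‖ ^ 2 < (2 * τ * d) ^ 2 := by
    rw [zero_mul, add_zero]; gcongr
  obtain ⟨k, hk⟩ := (hlim.eventually (gt_mem_nhds hlt)).exists
  refine ⟨k, ?_⟩
  have hα : 0 < q ^ k := pow_pos hq0 k
  have h := tikhonov_functional_le K hα z x
  refine le_of_sq_le_sq ?_ ht.le
  nlinarith [mul_nonneg hα.le (sq_nonneg ‖tikhonov K (q ^ k) z‖)]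

end Tikhonov

/-! ### The discrepancy principle and convergence without source condition. -/

section Discrepancy

variable {E F : Type*} [NormedAddCommGroup E] [InnerProductSpace ℝ E] [CompleteSpace E]
  [NormedAddCommGroup F] [InnerProductSpace ℝ F] [CompleteSpace F]

/-- The approximation error of the Tikhonov regularisation for exact data `K x`. -/
noncomputable def approxError (K : E →L[ℝ] F) (α : ℝ) (x : E) : E := x - tikhonov K α (K x)

/-- The approximation error is `α (K*K + α)⁻¹ x`; this form is what can be evaluated on spectral
sums. -/
lemma approxError_eq (K : E →L[ℝ] F) {α : ℝ} (hα : 0 < α) {x v : E}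
    (h : K.adjoint (K v) + α • v = α • x) : approxError K α x = v := by
  have : tikhonov K α (K x) = x - v := by
    refine tikhonov_eq K hα ?_
    rw [map_sub, map_sub, smul_sub, ← h]
    abel
  rw [approxError, this, sub_sub_cancel]

lemma approxError_normal_equation (K : E →L[ℝ] F) {α : ℝ} (hα : 0 < α) (x : E) :
    K.adjoint (K (approxError K α x)) + α • approxError K α x = α • x := by
  have h := tikhonov_normal_equation K hα (K x)
  rw [approxError, map_sub, map_sub, smul_sub, ← h]
  abel

/-- The normal equation tested with the approximation error itself. -/
lemma approxError_energy (K : E →L[ℝ] F) {α : ℝ} (hα : 0 < α) (x : E) :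
    ‖K (approxError K α x)‖ ^ 2 + α * ‖approxError K α x‖ ^ 2
      = α * inner ℝ x (approxError K α x) := by
  rw [← real_inner_smul_left, ← approxError_normal_equation K hα x, inner_add_left,
    ContinuousLinearMap.adjoint_inner_left, real_inner_smul_left, real_inner_self_eq_norm_sq,
    real_inner_self_eq_norm_sq]

lemma norm_approxError_sq_le_inner (K : E →L[ℝ] F) {α : ℝ} (hα : 0 < α) (x : E) :
    ‖approxError K α x‖ ^ 2 ≤ inner ℝ x (approxError K α x) := by
  have h := approxError_energy K hα x
  refine le_of_mul_le_mul_left ?_ hα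
  nlinarith [sq_nonneg ‖K (approxError K α x)‖]

lemma norm_approxError_le (K : E →L[ℝ] F) {α : ℝ} (hα : 0 < α) (x : E) :
    ‖approxError K α x‖ ≤ ‖x‖ := by
  have h := norm_approxError_sq_le_inner K hα x
  have h2 := real_inner_le_norm x (approxError K α x)
  by_contra hlt
  nlinarith [norm_nonneg x]

lemma approxError_sub (K : E →L[ℝ] F) {α : ℝ} (hα : 0 < α) (x x' : E) :
    approxError K α x - approxError K α x' = approxError K α (x - x') := by
  simp only [approxError, map_sub, tikhonov_sub K hα]
  abel

lemma continuous_approxError (K : E →L[ℝ] F) {α : ℝ} (hα : 0 < α) :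
    Continuous (approxError K α) := by
  refine LipschitzWith.continuous (K := 1) (LipschitzWith.of_dist_le_mul fun x x' => ?_)
  rw [dist_eq_norm, dist_eq_norm, approxError_sub K hα, NNReal.coe_one, one_mul]
  exact norm_approxError_le K hα _

lemma inner_adjoint_add_le (K : E →L[ℝ] F) (u : F) (r v : E) :
    inner ℝ (K.adjoint u + r) v ≤ ‖u‖ * ‖K v‖ + ‖r‖ * ‖v‖ := by
  rw [inner_add_left, ContinuousLinearMap.adjoint_inner_left]
  exact add_le_add (real_inner_le_norm _ _) (real_inner_le_norm _ _)

/-- If `x` is `K* u` up to a small `r`, the exact-data residual is `O(α)` plus a small multiple of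
`√α`. Together with density of the range of `K*` this yields the residual `o(√α)`. -/
lemma norm_map_approxError_le (K : E →L[ℝ] F) {α : ℝ} (hα : 0 < α) (u : F) (r : E) :
    ‖K (approxError K α (K.adjoint u + r))‖ ≤ α * ‖u‖ + √α * ‖r‖ := by
  set v := approxError K α (K.adjoint u + r)
  have h := approxError_energy K hα (K.adjoint u + r)
  have h2 := mul_le_mul_of_nonneg_left (inner_adjoint_add_le K u r v) hα.le
  have hs : √α ^ 2 = α := Real.sq_sqrt hα.le
  have hs0 := Real.sqrt_pos.2 hα
  set s := √α
  by_contra! hlt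
  have h4 : ‖K v‖ ^ 2 + (s * ‖v‖) ^ 2 ≤ α * ‖u‖ * ‖K v‖ + (s * ‖r‖) * (s * ‖v‖) := by
    calc ‖K v‖ ^ 2 + (s * ‖v‖) ^ 2 = ‖K v‖ ^ 2 + α * ‖v‖ ^ 2 := by rw [mul_pow, hs]
      _ ≤ _ := h.trans_le h2
      _ = _ := by rw [← hs]; ring
  have h5 : (s * ‖r‖) * (s * ‖r‖) ≤ (‖K v‖ - α * ‖u‖) * ‖K v‖ := by
    have : 0 ≤ s * ‖r‖ := by positivity
    have : 0 ≤ α * ‖u‖ := by positivity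
    apply mul_le_mul <;> linarith
  have h6 : 0 ≤ s * ‖r‖ := by positivity
  -- With `a = ‖K v‖`, `b = s ‖v‖`, `p = α ‖u‖`, `q = s ‖r‖`, the energy bound is `a² + b² ≤ p a + q
  -- b`. But `a (a - p) ≥ q²` and `b² - q b ≥ -q²/4`, a contradiction unless `q = 0`, which is
  -- settled separately.
  have h7 : 0 < s * ‖r‖ ∨ s * ‖r‖ = 0 := by
    rcases h6.lt_or_eq with h | h
    · exact Or.inl h
    · exact Or.inr h.symm
  rcases h7 with h7 | h7
  · nlinarith [sq_nonneg (s * ‖v‖ - s * ‖r‖ / 2)]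
  · rw [h7] at h4 hlt
    have : 0 ≤ α * ‖u‖ := by positivity
    nlinarith [sq_nonneg (s * ‖v‖)]

/-- The closure of the range of `K*` is the orthogonal complement of `ker K = 0`. -/
lemma mem_closure_range_adjoint (K : E →L[ℝ] F) (hinj : Function.Injective K) (x : E) {η : ℝ}
    (hη : 0 < η) : ∃ u : F, ‖x - K.adjoint u‖ < η := by
  have h := K.orthogonal_ker
  have hk : K.ker = ⊥ := LinearMap.ker_eq_bot.2 hinj
  rw [hk, Submodule.bot_orthogonal_eq_top] at h
  have hx : x ∈ K.adjoint.range.topologicalClosure := h ▸ Submodule.mem_top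
  have hx' : x ∈ closure (K.adjoint.range : Set E) := hx
  obtain ⟨z, ⟨u, rfl⟩, hz⟩ := Metric.mem_closure_iff.1 hx' η hη
  exact ⟨u, by rwa [dist_eq_norm] at hz⟩

/-- What the discrepancy principle yields for data `Z` close to the exact data `K x`. -/
lemma discrepancyParameter_spec (K : E →L[ℝ] F) (hd : DenseRange K) {τ q d : ℝ} (hτ : 1 < τ)
    (hq0 : 0 < q) (hq1 : q < 1) (hdpos : 0 < d) {x : E} {Z : F}
    (hZ : ‖Z - K x‖ ≤ (1 + τ) * d) :
    ∃ α : ℝ, α = discrepancyParameter K Z τ q d ∧ 0 < α ∧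
      ‖K (approxError K α x)‖ ≤ (3 * τ + 1) * d ∧
      ‖tikhonov K α Z - x‖ ≤ (1 + τ) * d / √α + ‖approxError K α x‖ ∧
      (α = 1 ∨ ∃ β, 0 < β ∧ α = q * β ∧ (τ - 1) * d < ‖K (approxError K β x)‖) := by
  have hne := admissibleIndices_nonempty K hd Z hq0 hq1 (zero_lt_one.trans hτ) hdpos
  set k := sInf (admissibleIndices K Z τ q d) with hk
  have hmem : k ∈ admissibleIndices K Z τ q d := Nat.sInf_mem hne
  have hα : 0 < q ^ k := pow_pos hq0 k
  -- Residual of the data = residual of the data error (at most `(1 + τ) d`) minus exact-data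
  -- residual. With the threshold `2 τ d` this gives the constants `2τ + (1 + τ)` and `2τ - (1 +
  -- τ)`.
  have hdec : ∀ γ : ℝ, 0 < γ → K (tikhonov K γ Z) - Z
      = (K (tikhonov K γ (Z - K x)) - (Z - K x)) - K (approxError K γ x) := by
    intro γ hγ
    rw [tikhonov_sub K hγ, approxError, map_sub, map_sub]
    abel
  refine ⟨q ^ k, rfl, hα, ?_, ?_, ?_⟩
  · have h1 : K (approxError K (q ^ k) x) = (K (tikhonov K (q ^ k) (Z - K x)) - (Z - K x))
        - (K (tikhonov K (q ^ k) Z) - Z) := by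
      rw [hdec _ hα]; abel
    rw [h1]
    have h2 : ‖K (tikhonov K (q ^ k) Z) - Z‖ ≤ 2 * τ * d := hmem
    have h3 := norm_residual_le K hα (Z - K x)
    refine (norm_sub_le _ _).trans ?_
    linarith
  · have h1 : tikhonov K (q ^ k) Z - x
        = tikhonov K (q ^ k) (Z - K x) - approxError K (q ^ k) x := by
      rw [tikhonov_sub K hα, approxError]; abel
    rw [h1]
    refine (norm_sub_le _ _).trans (add_le_add ?_ le_rfl)
    rw [le_div_iff₀ (Real.sqrt_pos.2 hα), mul_comm]
    exact (sqrt_mul_norm_tikhonov_le K hα _).trans hZ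
  · rcases Nat.eq_zero_or_pos k with h0 | h0
    · left; rw [h0, pow_zero]
    · right
      obtain ⟨j, hj⟩ : ∃ j, k = j + 1 := ⟨k - 1, by omega⟩
      have hβ : 0 < q ^ j := pow_pos hq0 j
      refine ⟨q ^ j, hβ, by rw [hj, pow_succ, mul_comm], ?_⟩
      have hnot : j ∉ admissibleIndices K Z τ q d := Nat.notMem_of_lt_sInf (by omega)
      have h2 : 2 * τ * d < ‖K (tikhonov K (q ^ j) Z) - Z‖ := not_le.1 hnot
      rw [hdec _ hβ] at h2
      have h3 := norm_residual_le K hβ (Z - K x)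
      have h4 := norm_sub_le (K (tikhonov K (q ^ j) (Z - K x)) - (Z - K x))
        (K (approxError K (q ^ j) x))
      linarith

/-- Convergence of the Tikhonov regularisation under the discrepancy principle. -/
theorem tikhonov_discrepancy_convergence (K : E →L[ℝ] F) (hinj : Function.Injective K)
    (hd : DenseRange K) {τ q : ℝ} (hτ : 1 < τ) (hq0 : 0 < q) (hq1 : q < 1) (x : E) {ε : ℝ}
    (hε : 0 < ε) :
    ∃ d₀ > 0, ∀ d, 0 < d → d < d₀ → ∀ Z : F, ‖Z - K x‖ ≤ (1 + τ) * d →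
      ‖tikhonov K (discrepancyParameter K Z τ q d) Z - x‖ < ε := by
  -- Chosen so that `d ≤ c √β` and `α = q β` make the propagated error at most `ε / 2`.
  set c := ε * √q / (2 * (1 + τ)) with hc
  have hsq := Real.sqrt_pos.2 hq0
  have hcpos : 0 < c := by positivity
  have hτ1 : 0 < τ - 1 := by linarith
  -- The first bound lets `r` account for half of `(τ - 1) d`, the second for `ε² / 8` in the
  -- approximation error.
  set η := min (c * (τ - 1) / 2) (ε ^ 2 / (8 * (‖x‖ + 1))) with hη
  have hxp : 0 < ‖x‖ + 1 := by positivity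
  have hηpos : 0 < η := by
    refine lt_min (by positivity) (by positivity)
  obtain ⟨u, hu⟩ := mem_closure_range_adjoint K hinj x hηpos
  set r := x - K.adjoint u with hr
  have hxr : K.adjoint u + r = x := by rw [hr]; abel
  set U := ‖u‖ + 1 with hU
  have hUpos : 0 < U := by positivity
  refine ⟨min (ε / (2 * (1 + τ))) (min ((τ - 1) * c ^ 2 / (2 * U)) (ε ^ 2 / (8 * U * (3 * τ + 1)))),
    by positivity, fun d hdpos hdlt Z hZ => ?_⟩
  obtain ⟨hd1, hd2, hd3⟩ : d < ε / (2 * (1 + τ)) ∧ d < (τ - 1) * c ^ 2 / (2 * U) ∧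
      d < ε ^ 2 / (8 * U * (3 * τ + 1)) := by simpa [lt_min_iff] using hdlt
  obtain ⟨α, hαdef, hα, hres, herr, hcase⟩ :=
    discrepancyParameter_spec K hd hτ hq0 hq1 hdpos hZ
  rw [← hαdef]
  -- No convergence `α → 0` is needed: `‖v‖² ≤ ⟪x, v⟫ = ⟪u, K v⟫ + ⟪r, v⟫`, and `‖K v‖` is `O(d)` by
  -- the stopping rule.
  have happ : ‖approxError K α x‖ < ε / 2 := by
    have h1 := norm_approxError_sq_le_inner K hα x
    have h2 := inner_adjoint_add_le K u r (approxError K α x)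
    rw [hxr] at h2
    have h3 := norm_approxError_le K hα x
    have h4 : ‖u‖ * ‖K (approxError K α x)‖ ≤ U * ((3 * τ + 1) * d) := by
      apply mul_le_mul _ hres (norm_nonneg _) hUpos.le
      rw [hU]; linarith
    have h5 : ‖r‖ * ‖approxError K α x‖ ≤ ε ^ 2 / (8 * (‖x‖ + 1)) * (‖x‖ + 1) := by
      apply mul_le_mul _ _ (norm_nonneg _) (by positivity)
      · exact hu.le.trans (min_le_right _ _)
      · linarith
    have h6 : ε ^ 2 / (8 * (‖x‖ + 1)) * (‖x‖ + 1) = ε ^ 2 / 8 := by field_simp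
    have h7 : U * ((3 * τ + 1) * d) < ε ^ 2 / 8 := by
      rw [lt_div_iff₀ (by positivity)] at hd3
      linarith
    refine lt_of_pow_lt_pow_left₀ 2 (by positivity) ?_
    rw [h6] at h5
    nlinarith
  have hprop : (1 + τ) * d / √α ≤ ε / 2 := by
    rcases hcase with h1 | ⟨β, hβ, hαβ, hlow⟩
    · rw [h1, Real.sqrt_one, div_one]
      rw [lt_div_iff₀ (by positivity)] at hd1
      linarith
    · have hsβ := Real.sqrt_pos.2 hβ
      -- For `√β < d / c` the exact-data residual at `β` would be at most `(τ - 1) d`, although the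
      -- test failed there.
      have hkey : d ≤ c * √β := by
        by_contra! hlt
        have h2 := norm_map_approxError_le K hβ u r
        rw [hxr] at h2
        have h3 : √β < d / c := by rw [lt_div_iff₀ hcpos]; linarith
        have h4 : β * ‖u‖ ≤ (d / c) ^ 2 * U := by
          apply mul_le_mul _ _ (norm_nonneg _) (by positivity)
          · rw [← Real.sq_sqrt hβ.le]; gcongr
          · rw [hU]; linarith
        have h5 : √β * ‖r‖ ≤ (d / c) * (c * (τ - 1) / 2) :=
          mul_le_mul h3.le (hu.le.trans (min_le_left _ _)) (norm_nonneg _) (by positivity)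
        have h6 : (d / c) * (c * (τ - 1) / 2) = d * ((τ - 1) / 2) := by field_simp
        have h7 : (d / c) ^ 2 * U ≤ d * ((τ - 1) / 2) := by
          have h8 : (d / c) ^ 2 * U = d * (d * U / c ^ 2) := by field_simp
          rw [h8]
          refine mul_le_mul_of_nonneg_left ?_ hdpos.le
          rw [div_le_iff₀ (by positivity)]
          rw [lt_div_iff₀ (by positivity)] at hd2
          linarith
        linarith
      rw [hαβ, Real.sqrt_mul hq0.le, div_le_iff₀ (by positivity)]
      calc (1 + τ) * d ≤ (1 + τ) * (c * √β) := by gcongr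
        _ = ε / 2 * (√q * √β) := by rw [hc]; field_simp
  linarith

end Discrepancy

/-! ### Convergence rates under the source condition. -/

section SourceCondition

variable {E F : Type*} [NormedAddCommGroup E] [InnerProductSpace ℝ E] [CompleteSpace E]
  [NormedAddCommGroup F] [InnerProductSpace ℝ F] [CompleteSpace F]

/-- The constant of the convergence rate. -/
noncomputable def rateConstant (τ q ν : ℝ) : ℝ :=
  (1 + τ) * (1 + (τ - 1) ^ (-(1 / (ν + 1))) / √q) + 2 * (3 * τ + 1)

lemma interpolation_le {ν ρ e a b : ℝ} (hν : 0 < ν) (hρ : 0 < ρ) (he : 0 < e)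
    (hb : 0 ≤ b) (hbe : b ≤ e)
    (h : ∀ t : ℝ, 0 < t → a ^ 2 ≤ t * b ^ 2 + t ^ (-ν) * ρ ^ 2) :
    a ≤ 2 * (ρ ^ (1 / (ν + 1)) * e ^ (ν / (ν + 1))) := by
  -- This `t` balances the two terms: both equal the square of the target once `b` is replaced by
  -- `e`.
  have h1 := h ((ρ / e) ^ (2 / (ν + 1))) (by positivity)
  have h2 : (ρ / e) ^ (2 / (ν + 1)) * b ^ 2 ≤ (ρ / e) ^ (2 / (ν + 1)) * e ^ 2 := by gcongr
  have hν1 : ν + 1 ≠ 0 := by positivity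
  -- Exponential coordinates turn the power identities into linear identities between exponents.
  obtain ⟨r, rfl⟩ : ∃ r, Real.exp r = ρ := ⟨_, Real.exp_log hρ⟩
  obtain ⟨f, rfl⟩ : ∃ f, Real.exp f = e := ⟨_, Real.exp_log he⟩
  set G := Real.exp r ^ (1 / (ν + 1)) * Real.exp f ^ (ν / (ν + 1)) with hG
  have hGpos : 0 < G := by positivity
  have h3 : (Real.exp r / Real.exp f) ^ (2 / (ν + 1)) * Real.exp f ^ 2 = G ^ 2 := by
    rw [hG, ← Real.exp_sub, ← Real.exp_mul, ← Real.exp_mul, ← Real.exp_mul, ← Real.exp_add,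
      ← Real.exp_nat_mul, ← Real.exp_nat_mul, ← Real.exp_add]
    congr 1
    push_cast
    field_simp
    ring
  have h4 : ((Real.exp r / Real.exp f) ^ (2 / (ν + 1))) ^ (-ν) * Real.exp r ^ 2 = G ^ 2 := by
    rw [hG, ← Real.exp_sub, ← Real.exp_mul, ← Real.exp_mul, ← Real.exp_mul, ← Real.exp_mul,
      ← Real.exp_add, ← Real.exp_nat_mul, ← Real.exp_nat_mul, ← Real.exp_add]
    congr 1
    push_cast
    field_simp
    ring
  refine le_of_sq_le_sq ?_ (by positivity)
  nlinarith

/-- The convergence rate under the discrepancy principle, from the qualification estimates. -/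
theorem tikhonov_discrepancy_rate (K : E →L[ℝ] F) (hd : DenseRange K) {τ q d ν ρ : ℝ}
    (hτ : 1 < τ) (hq0 : 0 < q) (hq1 : q < 1) (hdpos : 0 < d) (hν : 0 < ν) (hρ : 0 < ρ)
    (hdρ : d ≤ ρ) {x : E}
    (hK : ∀ β, 0 < β → ‖K (approxError K β x)‖ ≤ β ^ ((ν + 1) / 2) * ρ)
    (hI : ∀ β, 0 < β → ∀ t : ℝ, 0 < t → ‖approxError K β x‖ ^ 2
      ≤ t * ‖K (approxError K β x)‖ ^ 2 + t ^ (-ν) * ρ ^ 2)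
    {Z : F} (hZ : ‖Z - K x‖ ≤ (1 + τ) * d) :
    ‖tikhonov K (discrepancyParameter K Z τ q d) Z - x‖
      ≤ rateConstant τ q ν * ρ ^ (1 / (ν + 1)) * d ^ (ν / (ν + 1)) := by
  obtain ⟨α, hαdef, hα, hres, herr, hcase⟩ :=
    discrepancyParameter_spec K hd hτ hq0 hq1 hdpos hZ
  rw [← hαdef]
  set G := ρ ^ (1 / (ν + 1)) * d ^ (ν / (ν + 1)) with hG
  have hGpos : 0 < G := by positivity
  have hτ1 : 0 < τ - 1 := by linarith
  have hν1 : ν + 1 ≠ 0 := by positivity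
  have hsq := Real.sqrt_pos.2 hq0
  have happ : ‖approxError K α x‖ ≤ 2 * (3 * τ + 1) * G := by
    have h1 := interpolation_le hν hρ (by positivity) (norm_nonneg _) hres
      (hI α hα)
    have h2 : ((3 * τ + 1) * d) ^ (ν / (ν + 1)) ≤ (3 * τ + 1) * d ^ (ν / (ν + 1)) := by
      rw [Real.mul_rpow (by positivity) hdpos.le]
      gcongr
      refine (Real.rpow_le_rpow_of_exponent_le (by linarith) (?_ : ν / (ν + 1) ≤ 1)).trans_eq
        (Real.rpow_one _)
      rw [div_le_one (by positivity)]; linarith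
    calc _ ≤ _ := h1
      _ ≤ 2 * (ρ ^ (1 / (ν + 1)) * ((3 * τ + 1) * d ^ (ν / (ν + 1)))) := by gcongr
      _ = _ := by rw [hG]; ring
  -- This uses `d ≤ ρ` and covers the case where the search stops at once with `α = 1`.
  have hGd : d ≤ G := by
    have : d = d ^ (1 / (ν + 1)) * d ^ (ν / (ν + 1)) := by
      rw [← Real.rpow_add hdpos, ← add_div, add_comm 1 ν, div_self hν1, Real.rpow_one]
    calc d = _ := this
      _ ≤ G := by rw [hG]; gcongr
  have hC : 0 ≤ (τ - 1) ^ (-(1 / (ν + 1))) / √q := by positivity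
  have hprop : (1 + τ) * d / √α ≤ (1 + τ) * (1 + (τ - 1) ^ (-(1 / (ν + 1))) / √q) * G := by
    rcases hcase with h1 | ⟨β, hβ, hαβ, hlow⟩
    · rw [h1, Real.sqrt_one, div_one]
      have : (1 + τ) * d ≤ (1 + τ) * G := by gcongr
      have h3 : 0 ≤ (1 + τ) * ((τ - 1) ^ (-(1 / (ν + 1))) / √q) * G := by positivity
      linarith
    · have hlow2 := hlow.le.trans (hK β hβ)
      have hsβ := Real.sqrt_pos.2 hβ
      -- The failed test at `β` together with the qualification estimate bounds `√β` from below.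
      have h2 : ((τ - 1) * d) ^ (1 / (ν + 1)) ≤ √β * ρ ^ (1 / (ν + 1)) := by
        calc _ ≤ (β ^ ((ν + 1) / 2) * ρ) ^ (1 / (ν + 1)) := by gcongr
          _ = _ := by
            rw [Real.mul_rpow (by positivity) hρ.le, ← Real.rpow_mul hβ.le, Real.sqrt_eq_rpow]
            congr 2
            field_simp
      have h3 : d ≤ √β * ((τ - 1) ^ (-(1 / (ν + 1))) * G) := by
        have h4 : d = (τ - 1) ^ (-(1 / (ν + 1))) * d ^ (ν / (ν + 1))
            * ((τ - 1) * d) ^ (1 / (ν + 1)) := by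
          rw [Real.mul_rpow hτ1.le hdpos.le, Real.rpow_neg hτ1.le]
          have h5 : d = d ^ (ν / (ν + 1)) * d ^ (1 / (ν + 1)) := by
            rw [← Real.rpow_add hdpos, ← add_div, div_self hν1, Real.rpow_one]
          conv_lhs => rw [h5]
          have : (τ - 1) ^ (1 / (ν + 1)) ≠ 0 := by positivity
          field_simp
        calc d = _ := h4
          _ ≤ (τ - 1) ^ (-(1 / (ν + 1))) * d ^ (ν / (ν + 1)) * (√β * ρ ^ (1 / (ν + 1))) := by
            gcongr
          _ = _ := by rw [hG]; ring
      rw [hαβ, Real.sqrt_mul hq0.le, div_le_iff₀ (by positivity)]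
      have h6 : (1 + τ) * (1 + (τ - 1) ^ (-(1 / (ν + 1))) / √q) * G * (√q * √β)
          = (1 + τ) * (√β * ((τ - 1) ^ (-(1 / (ν + 1))) * G)) + (1 + τ) * G * (√q * √β) := by
        field_simp
        ring
      rw [h6]
      have : (1 + τ) * d ≤ (1 + τ) * (√β * ((τ - 1) ^ (-(1 / (ν + 1))) * G)) := by gcongr
      have h7 : 0 ≤ (1 + τ) * G * (√q * √β) := by positivity
      linarith
  calc _ ≤ _ := herr
    _ ≤ (1 + τ) * (1 + (τ - 1) ^ (-(1 / (ν + 1))) / √q) * G + 2 * (3 * τ + 1) * G :=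
      add_le_add hprop happ
    _ = _ := by rw [rateConstant, hG]; ring

/-- The orthogonal projection onto an eigenspace of `K* K`. -/
noncomputable abbrev eigenProj (K : E →L[ℝ] F) (lam : ℝ) (w : E) : E :=
  (Module.End.eigenspace ((K.adjoint ∘L K : E →L[ℝ] E) : E →ₗ[ℝ] E) lam).starProjection w

lemma adjoint_map_eigenProj (K : E →L[ℝ] F) (lam : ℝ) (w : E) :
    K.adjoint (K (eigenProj K lam w)) = lam • eigenProj K lam w :=
  Module.End.mem_eigenspace_iff.1 (Submodule.starProjection_apply_mem
    (Module.End.eigenspace ((K.adjoint ∘L K : E →L[ℝ] E) : E →ₗ[ℝ] E) lam) w)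

/-- `K*K` is positive. The spectral sum runs over all reals, so negative indices must be discarded.
-/
lemma eigenProj_eq_zero (K : E →L[ℝ] F) {lam : ℝ} (h : lam < 0) (w : E) :
    eigenProj K lam w = 0 := by
  have h1 : ‖K (eigenProj K lam w)‖ ^ 2 = lam * ‖eigenProj K lam w‖ ^ 2 := by
    rw [← real_inner_self_eq_norm_sq, ← real_inner_self_eq_norm_sq, ← real_inner_smul_left,
      ← adjoint_map_eigenProj, ContinuousLinearMap.adjoint_inner_left]
  have h2 : ‖eigenProj K lam w‖ ^ 2 ≤ 0 := by
    by_contra! h3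
    nlinarith [sq_nonneg ‖K (eigenProj K lam w)‖]
  exact norm_eq_zero.1 (pow_eq_zero_iff two_ne_zero |>.1 (le_antisymm h2 (sq_nonneg _)))

lemma inner_eigenProj_of_ne (K : E →L[ℝ] F) {a b : ℝ} (h : a ≠ b) (w w' : E) :
    inner ℝ (eigenProj K a w) (eigenProj K b w') = 0 := by
  have h1 : a * inner ℝ (eigenProj K a w) (eigenProj K b w')
      = b * inner ℝ (eigenProj K a w) (eigenProj K b w') := by
    rw [← real_inner_smul_left, ← real_inner_smul_right, ← adjoint_map_eigenProj,
      ← adjoint_map_eigenProj, ContinuousLinearMap.adjoint_inner_left,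
      ContinuousLinearMap.adjoint_inner_right]
  by_contra hne
  exact h (mul_right_cancel₀ hne h1)

lemma inner_eigenProj_right (K : E →L[ℝ] F) (a : ℝ) (w : E) :
    inner ℝ (eigenProj K a w) w = ‖eigenProj K a w‖ ^ 2 := by
  rw [← real_inner_self_eq_norm_sq]
  have h := Submodule.starProjection_inner_eq_zero (K := Module.End.eigenspace
    ((K.adjoint ∘L K : E →L[ℝ] E) : E →ₗ[ℝ] E) a) w (eigenProj K a w)
    (Submodule.starProjection_apply_mem _ w)
  rw [inner_sub_left, sub_eq_zero, real_inner_comm] at h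
  exact h

lemma inner_sum_eigenProj (K : E →L[ℝ] F) (s : Finset ℝ) (a b : ℝ → ℝ) (w : E) :
    inner ℝ (∑ l ∈ s, a l • eigenProj K l w) (∑ l ∈ s, b l • eigenProj K l w)
      = ∑ l ∈ s, a l * b l * ‖eigenProj K l w‖ ^ 2 := by
  rw [sum_inner]
  refine Finset.sum_congr rfl fun l hl => ?_
  rw [inner_sum, Finset.sum_eq_single_of_mem l hl]
  · rw [real_inner_smul_left, real_inner_smul_right, real_inner_self_eq_norm_sq]; ring
  · intro l' _ hne
    rw [real_inner_smul_left, real_inner_smul_right, inner_eigenProj_of_ne K hne.symm]; simp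

lemma norm_sq_sum_eigenProj (K : E →L[ℝ] F) (s : Finset ℝ) (a : ℝ → ℝ) (w : E) :
    ‖∑ l ∈ s, a l • eigenProj K l w‖ ^ 2 = ∑ l ∈ s, a l ^ 2 * ‖eigenProj K l w‖ ^ 2 := by
  rw [← real_inner_self_eq_norm_sq, inner_sum_eigenProj]
  simp_rw [sq]

lemma adjoint_map_sum_eigenProj (K : E →L[ℝ] F) (s : Finset ℝ) (a : ℝ → ℝ) (w : E) :
    K.adjoint (K (∑ l ∈ s, a l • eigenProj K l w)) = ∑ l ∈ s, (l * a l) • eigenProj K l w := by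
  simp only [map_sum, map_smul]
  refine Finset.sum_congr rfl fun l _ => ?_
  rw [adjoint_map_eigenProj, smul_smul, mul_comm]

lemma norm_sq_map_sum_eigenProj (K : E →L[ℝ] F) (s : Finset ℝ) (a : ℝ → ℝ) (w : E) :
    ‖K (∑ l ∈ s, a l • eigenProj K l w)‖ ^ 2
      = ∑ l ∈ s, l * a l ^ 2 * ‖eigenProj K l w‖ ^ 2 := by
  rw [← real_inner_self_eq_norm_sq, ← ContinuousLinearMap.adjoint_inner_left,
    adjoint_map_sum_eigenProj, inner_sum_eigenProj]
  refine Finset.sum_congr rfl fun l _ => ?_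
  ring

/-- Bessel's inequality for the mutually orthogonal eigenspaces. -/
lemma sum_norm_sq_eigenProj_le (K : E →L[ℝ] F) (s : Finset ℝ) (w : E) :
    ∑ l ∈ s, ‖eigenProj K l w‖ ^ 2 ≤ ‖w‖ ^ 2 := by
  have h1 := norm_sq_sum_eigenProj K s (fun _ => 1) w
  simp only [one_smul, one_pow, one_mul] at h1
  have h2 : inner ℝ (∑ l ∈ s, eigenProj K l w) w = ∑ l ∈ s, ‖eigenProj K l w‖ ^ 2 := by
    rw [sum_inner]
    exact Finset.sum_congr rfl fun l _ => inner_eigenProj_right K l w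
  have h3 := real_inner_le_norm (∑ l ∈ s, eigenProj K l w) w
  rw [h2, ← h1] at h3
  rw [← h1]
  nlinarith [sq_nonneg (‖∑ l ∈ s, eigenProj K l w‖ - ‖w‖)]

lemma approxError_sum_eigenProj (K : E →L[ℝ] F) {β : ℝ} (hβ : 0 < β) (s : Finset ℝ) (a : ℝ → ℝ)
    (w : E) : approxError K β (∑ l ∈ s, a l • eigenProj K l w)
      = ∑ l ∈ s, (β / (l + β) * a l) • eigenProj K l w := by
  refine approxError_eq K hβ ?_
  rw [adjoint_map_sum_eigenProj, Finset.smul_sum, Finset.smul_sum, ← Finset.sum_add_distrib]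
  refine Finset.sum_congr rfl fun l _ => ?_
  rcases lt_or_ge l 0 with hl | hl
  · simp [eigenProj_eq_zero K hl]
  · rw [smul_smul, smul_smul, ← add_smul]
    congr 1
    have : l + β ≠ 0 := by positivity
    field_simp

/-- Below `β` the filter is at most `1`; above it, `l ^ (p - 1)` is decreasing because `p ≤ 1`. With
`p = (ν + 1) / 2` this is where `ν ≤ 1` enters. -/
lemma filter_qualification {l β p : ℝ} (hl : 0 ≤ l) (hβ : 0 < β) (hp : 0 < p) (hp1 : p ≤ 1) :
    l ^ p * (β / (l + β)) ≤ β ^ p := by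
  rw [← mul_div_assoc, div_le_iff₀ (by positivity)]
  rcases le_or_gt l β with h | h
  · have h1 : l ^ p ≤ β ^ p := by gcongr
    have h2 : 0 ≤ β ^ p := by positivity
    nlinarith
  · have hl0 : 0 < l := hβ.trans h
    have h1 : l ^ (p - 1) ≤ β ^ (p - 1) :=
      Real.rpow_le_rpow_of_nonpos hβ h.le (by linarith)
    have h2 : l ^ p = l ^ (p - 1) * l := by
      rw [← Real.rpow_add_one hl0.ne', sub_add_cancel]
    have h3 : β ^ p = β ^ (p - 1) * β := by
      rw [← Real.rpow_add_one hβ.ne', sub_add_cancel]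
    rw [h2, h3]
    have h4 : 0 < β ^ (p - 1) := by positivity
    have h5 : l ^ (p - 1) * (l * β) ≤ β ^ (p - 1) * (l * β) := by gcongr
    have h6 : 0 < β ^ (p - 1) * β * β := by positivity
    linarith

lemma norm_map_approxError_sum_le (K : E →L[ℝ] F) {β ν ρ : ℝ} (hβ : 0 < β) (hν : 0 < ν)
    (hν1 : ν ≤ 1) {w : E} (hw : ‖w‖ ≤ ρ) (s : Finset ℝ) :
    ‖K (approxError K β (∑ l ∈ s, l ^ (ν / 2) • eigenProj K l w))‖
      ≤ β ^ ((ν + 1) / 2) * ρ := by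
  have hρ : 0 ≤ ρ := (norm_nonneg w).trans hw
  refine le_of_sq_le_sq ?_ (by positivity)
  rw [approxError_sum_eigenProj K hβ, norm_sq_map_sum_eigenProj, mul_pow]
  calc _ ≤ ∑ l ∈ s, (β ^ ((ν + 1) / 2)) ^ 2 * ‖eigenProj K l w‖ ^ 2 := by
        refine Finset.sum_le_sum fun l _ => ?_
        rcases lt_or_ge l 0 with hl | hl
        · simp [eigenProj_eq_zero K hl]
        · refine mul_le_mul_of_nonneg_right ?_ (sq_nonneg _)
          have h1 := filter_qualification hl hβ (p := (ν + 1) / 2) (by positivity) (by linarith)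
          have h2 : l * (β / (l + β) * l ^ (ν / 2)) ^ 2
              = (l ^ ((ν + 1) / 2) * (β / (l + β))) ^ 2 := by
            have h3 : l * (l ^ (ν / 2)) ^ 2 = (l ^ ((ν + 1) / 2)) ^ 2 := by
              rw [← Real.rpow_mul_natCast hl, ← Real.rpow_mul_natCast hl]
              rcases hl.eq_or_lt with h0 | h0
              · rw [← h0, zero_mul, Real.zero_rpow (by push_cast; positivity)]
              · rw [mul_comm, ← Real.rpow_add_one h0.ne']
                congr 1; push_cast; ring
            rw [mul_pow, mul_pow, ← h3]; ring
          rw [h2]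
          have : 0 ≤ l ^ ((ν + 1) / 2) * (β / (l + β)) := by positivity
          gcongr
    _ = (β ^ ((ν + 1) / 2)) ^ 2 * ∑ l ∈ s, ‖eigenProj K l w‖ ^ 2 := by rw [Finset.mul_sum]
    _ ≤ (β ^ ((ν + 1) / 2)) ^ 2 * ρ ^ 2 := by
        have := sum_norm_sq_eigenProj_le K s w
        gcongr
        refine this.trans ?_
        gcongr

/-- An interpolation inequality in additive form, proved eigenvalue by eigenvalue: for `l ≥ 1/t` use
`1 ≤ t l`, for `l < 1/t` use `l ^ ν ≤ t ^ (-ν)`. Unlike a product inequality it sums termwise. -/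
lemma norm_sq_approxError_sum_le (K : E →L[ℝ] F) {β ν ρ t : ℝ} (hβ : 0 < β) (hν : 0 < ν)
    (ht : 0 < t) {w : E} (hw : ‖w‖ ≤ ρ) (s : Finset ℝ) :
    ‖approxError K β (∑ l ∈ s, l ^ (ν / 2) • eigenProj K l w)‖ ^ 2
      ≤ t * ‖K (approxError K β (∑ l ∈ s, l ^ (ν / 2) • eigenProj K l w))‖ ^ 2
        + t ^ (-ν) * ρ ^ 2 := by
  rw [approxError_sum_eigenProj K hβ, norm_sq_map_sum_eigenProj, norm_sq_sum_eigenProj]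
  have h1 : ∑ l ∈ s, t ^ (-ν) * ‖eigenProj K l w‖ ^ 2 ≤ t ^ (-ν) * ρ ^ 2 := by
    rw [← Finset.mul_sum]
    have := sum_norm_sq_eigenProj_le K s w
    gcongr
    refine this.trans ?_
    gcongr
  refine le_trans ?_ (add_le_add le_rfl h1)
  rw [Finset.mul_sum, ← Finset.sum_add_distrib]
  refine Finset.sum_le_sum fun l _ => ?_
  rcases lt_or_ge l 0 with hl | hl
  · simp [eigenProj_eq_zero K hl]
  · rw [← mul_assoc, ← add_mul]
    refine mul_le_mul_of_nonneg_right ?_ (sq_nonneg _)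
    rw [mul_pow]
    set g := (β / (l + β)) ^ 2 with hg
    have hg0 : 0 ≤ g := sq_nonneg _
    have hg1 : g ≤ 1 := by
      refine pow_le_one₀ (by positivity) ?_
      rw [div_le_one (by positivity)]; linarith
    have h2 : (l ^ (ν / 2)) ^ 2 = l ^ ν := by
      rw [← Real.rpow_mul_natCast hl]; congr 1; push_cast; ring
    rw [h2]
    have h3 : 0 ≤ l ^ ν := by positivity
    have h4 : 0 < t ^ (-ν) := by positivity
    rcases le_or_gt t⁻¹ l with h | h
    · have h5 : 1 ≤ t * l := by
        rw [inv_le_iff_one_le_mul₀ ht] at h; linarith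
      have h6 : g * l ^ ν ≤ (t * l) * (g * l ^ ν) := le_mul_of_one_le_left (by positivity) h5
      linarith
    · have h5 : l ^ ν ≤ t ^ (-ν) := by
        rw [Real.rpow_neg ht.le, ← Real.inv_rpow ht.le]
        gcongr
      have h6 : g * l ^ ν ≤ 1 * t ^ (-ν) := by gcongr
      have h7 : 0 ≤ t * (l * (g * l ^ ν)) := by positivity
      linarith

/-- A closed property of all partial spectral sums passes to the spectral power. -/
lemma spectralPower_induction (K : E →L[ℝ] F) (p : ℝ) (w : E) {S : Set E} (hS : IsClosed S)
    (h : ∀ s : Finset ℝ, ∑ l ∈ s, l ^ p • eigenProj K l w ∈ S) :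
    spectralPower (K.adjoint ∘L K) p w ∈ S := by
  by_cases hsum : Summable fun l : ℝ => l ^ p • eigenProj K l w
  · exact hS.mem_of_tendsto hsum.hasSum (Eventually.of_forall h)
  -- A non-summable family has sum `0` by convention, which is also the empty partial sum, so no
  -- spectral theorem is needed.
  · have : spectralPower (K.adjoint ∘L K) p w = 0 := tsum_eq_zero_of_not_summable hsum
    rw [this]
    simpa using h ∅

lemma norm_map_approxError_spectralPower_le (K : E →L[ℝ] F) {β ν ρ : ℝ} (hβ : 0 < β)
    (hν : 0 < ν) (hν1 : ν ≤ 1) {w : E} (hw : ‖w‖ ≤ ρ) :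
    ‖K (approxError K β (spectralPower (K.adjoint ∘L K) (ν / 2) w))‖
      ≤ β ^ ((ν + 1) / 2) * ρ :=
  spectralPower_induction K (ν / 2) w
    (S := {x | ‖K (approxError K β x)‖ ≤ β ^ ((ν + 1) / 2) * ρ})
    (isClosed_le (K.continuous.comp (continuous_approxError K hβ)).norm continuous_const)
    (norm_map_approxError_sum_le K hβ hν hν1 hw)

lemma norm_sq_approxError_spectralPower_le (K : E →L[ℝ] F) {β ν ρ t : ℝ} (hβ : 0 < β)
    (hν : 0 < ν) (ht : 0 < t) {w : E} (hw : ‖w‖ ≤ ρ) :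
    ‖approxError K β (spectralPower (K.adjoint ∘L K) (ν / 2) w)‖ ^ 2
      ≤ t * ‖K (approxError K β (spectralPower (K.adjoint ∘L K) (ν / 2) w))‖ ^ 2
        + t ^ (-ν) * ρ ^ 2 := by
  have hcont := continuous_approxError K hβ
  have hcl : IsClosed {x : E | ‖approxError K β x‖ ^ 2
      ≤ t * ‖K (approxError K β x)‖ ^ 2 + t ^ (-ν) * ρ ^ 2} :=
    isClosed_le (hcont.norm.pow 2)
      ((((K.continuous.comp hcont).norm.pow 2).const_mul t).add continuous_const)
  have h := spectralPower_induction K (ν / 2) w hcl fun s => by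
    rw [Set.mem_ofPred_eq]
    exact norm_sq_approxError_sum_le K hβ hν ht hw s
  rwa [Set.mem_ofPred_eq] at h

end SourceCondition

/-! ### The error martingale and its maximal inequality. -/

section Noise

variable {Ω : Type*} [mΩ : MeasurableSpace Ω]

/-- Independent, identically distributed, centred errors with finite variance. -/
structure IsNoise (μ : Measure Ω) (δ : ℕ → ℕ → Ω → ℝ) : Prop where
  meas : ∀ i j, Measurable (δ i j)
  indep : iIndepFun (fun p : ℕ × ℕ => δ p.1 p.2) μ
  ident : ∀ i j, IdentDistrib (δ i j) (δ 0 0) μ μ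
  memLp : ∀ i j, MemLp (δ i j) 2 μ
  mean : ∀ i j, ∫ ω, δ i j ω ∂μ = 0

/-- The sigma-algebra generated by the errors with indices in `A`. -/
abbrev errorSigma (δ : ℕ → ℕ → Ω → ℝ) (A : Set (ℕ × ℕ)) : MeasurableSpace Ω :=
  ⨆ p ∈ A, MeasurableSpace.comap (δ p.1 p.2) inferInstance

lemma measurable_errorSigma (δ : ℕ → ℕ → Ω → ℝ) {A : Set (ℕ × ℕ)} {i j : ℕ} (h : (i, j) ∈ A) :
    Measurable[errorSigma δ A] (δ i j) :=
  (comap_measurable (δ i j)).mono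
    (le_iSup₂ (f := fun (p : ℕ × ℕ) (_ : p ∈ A) =>
      MeasurableSpace.comap (δ p.1 p.2) inferInstance) (i, j) h) le_rfl

lemma errorSigma_mono (δ : ℕ → ℕ → Ω → ℝ) {A B : Set (ℕ × ℕ)} (h : A ⊆ B) :
    errorSigma δ A ≤ errorSigma δ B := biSup_mono h

/-- The sum of the first `n` errors on channel `j`. -/
def errorSum (δ : ℕ → ℕ → Ω → ℝ) (j n : ℕ) (ω : Ω) : ℝ := ∑ i ∈ Finset.range n, δ i j ω

/-- The sum of all squared errors. -/
def errorSq (δ : ℕ → ℕ → Ω → ℝ) (m n : ℕ) (ω : Ω) : ℝ :=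
  ∑ j ∈ Finset.range m, ∑ i ∈ Finset.range n, δ i j ω ^ 2

/-- The martingale of the off-diagonal products of the errors. -/
def errorMart (δ : ℕ → ℕ → Ω → ℝ) (m n : ℕ) (ω : Ω) : ℝ :=
  ∑ j ∈ Finset.range m, (errorSum δ j n ω ^ 2 - ∑ i ∈ Finset.range n, δ i j ω ^ 2)

/-- The increments of `errorMart`. -/
def errorIncr (δ : ℕ → ℕ → Ω → ℝ) (m n : ℕ) (ω : Ω) : ℝ :=
  ∑ j ∈ Finset.range m, 2 * (errorSum δ j n ω * δ n j ω)

/-- The pooled sum of squared deviations from the channel means. -/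
noncomputable def errorDev (δ : ℕ → ℕ → Ω → ℝ) (m n : ℕ) (ω : Ω) : ℝ :=
  ∑ j ∈ Finset.range m, ∑ i ∈ Finset.range n, (δ i j ω - errorSum δ j n ω / n) ^ 2

lemma errorSum_succ (δ : ℕ → ℕ → Ω → ℝ) (j n : ℕ) (ω : Ω) :
    errorSum δ j (n + 1) ω = errorSum δ j n ω + δ n j ω := Finset.sum_range_succ _ _

lemma errorMart_succ (δ : ℕ → ℕ → Ω → ℝ) (m n : ℕ) (ω : Ω) :
    errorMart δ m (n + 1) ω = errorMart δ m n ω + errorIncr δ m n ω := by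
  simp only [errorMart, errorIncr, ← Finset.sum_add_distrib]
  refine Finset.sum_congr rfl fun j _ => ?_
  rw [errorSum_succ, Finset.sum_range_succ]
  ring

lemma sum_errorSum_sq (δ : ℕ → ℕ → Ω → ℝ) (m n : ℕ) (ω : Ω) :
    ∑ j ∈ Finset.range m, errorSum δ j n ω ^ 2 = errorMart δ m n ω + errorSq δ m n ω := by
  rw [errorMart, errorSq, ← Finset.sum_add_distrib]
  exact Finset.sum_congr rfl fun j _ => by ring

lemma sum_sub_sq {n : ℕ} (x : ℕ → ℝ) (b : ℝ) :
    ∑ i ∈ Finset.range n, (x i - b) ^ 2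
      = ∑ i ∈ Finset.range n, x i ^ 2 - 2 * b * ∑ i ∈ Finset.range n, x i + n * b ^ 2 := by
  simp only [sub_sq, Finset.sum_add_distrib, Finset.sum_sub_distrib, Finset.mul_sum,
    Finset.sum_const, Finset.card_range, nsmul_eq_mul]
  congr 2
  exact Finset.sum_congr rfl fun i _ => by ring

/-- Links the observable deviation with the martingale; combined with `sum_errorSum_sq` it expresses
the averaged error through these two. -/
lemma mul_errorDev (δ : ℕ → ℕ → Ω → ℝ) (m : ℕ) {n : ℕ} (hn : 1 ≤ n) (ω : Ω) :
    n * errorDev δ m n ω = (n - 1) * errorSq δ m n ω - errorMart δ m n ω := by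
  have hn0 : (n : ℝ) ≠ 0 := by positivity
  rw [errorDev, errorSq, errorMart, Finset.mul_sum, Finset.mul_sum, ← Finset.sum_sub_distrib]
  refine Finset.sum_congr rfl fun j _ => ?_
  rw [sum_sub_sq (fun i => δ i j ω), ← errorSum]
  field_simp
  ring

/-- The mean minimises the sum of squared deviations, and further samples only add squares. This
lets dyadic `n` control all `n`. -/
lemma errorDev_mono (δ : ℕ → ℕ → Ω → ℝ) (m : ℕ) {n n' : ℕ} (hn : 1 ≤ n) (h : n ≤ n') (ω : Ω) :
    errorDev δ m n ω ≤ errorDev δ m n' ω := by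
  have hn0 : (0 : ℝ) < n := by positivity
  refine Finset.sum_le_sum fun j _ => ?_
  calc ∑ i ∈ Finset.range n, (δ i j ω - errorSum δ j n ω / n) ^ 2
      ≤ ∑ i ∈ Finset.range n, (δ i j ω - errorSum δ j n' ω / n') ^ 2 := by
        generalize errorSum δ j n' ω / n' = b
        rw [sum_sub_sq (fun i => δ i j ω), sum_sub_sq (fun i => δ i j ω), ← errorSum]
        set a := errorSum δ j n ω / n with ha
        have : errorSum δ j n ω = n * a := by rw [ha]; field_simp
        rw [this]
        nlinarith [mul_nonneg hn0.le (sq_nonneg (a - b))]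
    _ ≤ _ := Finset.sum_le_sum_of_subset_of_nonneg (Finset.range_mono h)
        fun i _ _ => sq_nonneg _

lemma errorDev_le_errorSq (δ : ℕ → ℕ → Ω → ℝ) (m n : ℕ) (ω : Ω) :
    errorDev δ m n ω ≤ errorSq δ m n ω := by
  refine Finset.sum_le_sum fun j _ => ?_
  rw [sum_sub_sq (fun i => δ i j ω), ← errorSum]
  rcases n.eq_zero_or_pos with rfl | hn
  · simp
  · have hn0 : (0 : ℝ) < n := by positivity
    set a := errorSum δ j n ω / n with ha
    have : errorSum δ j n ω = n * a := by rw [ha]; field_simp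
    rw [this]
    nlinarith [mul_nonneg hn0.le (sq_nonneg a)]

variable {μ : Measure Ω} {δ : ℕ → ℕ → Ω → ℝ}

lemma measurable_errorSum_sigma (δ : ℕ → ℕ → Ω → ℝ) {A : Set (ℕ × ℕ)} {j n : ℕ}
    (h : ∀ i < n, (i, j) ∈ A) : Measurable[errorSigma δ A] (errorSum δ j n) :=
  Finset.measurable_sum _ fun i hi => measurable_errorSigma δ (h i (Finset.mem_range.1 hi))

lemma measurable_errorMart_sigma (δ : ℕ → ℕ → Ω → ℝ) {A : Set (ℕ × ℕ)} {m n : ℕ}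
    (h : ∀ i < n, ∀ j < m, (i, j) ∈ A) : Measurable[errorSigma δ A] (errorMart δ m n) :=
  Finset.measurable_sum _ fun j hj =>
    ((measurable_errorSum_sigma δ fun i hi => h i hi j (Finset.mem_range.1 hj)).pow_const 2).sub
      (Finset.measurable_sum _ fun i hi =>
        (measurable_errorSigma δ (h i (Finset.mem_range.1 hi) j
          (Finset.mem_range.1 hj))).pow_const 2)

namespace IsNoise

lemma errorSigma_le (h : IsNoise μ δ) (A : Set (ℕ × ℕ)) : errorSigma δ A ≤ mΩ :=
  iSup₂_le fun p _ => (h.meas p.1 p.2).comap_le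

lemma indepFun_of_measurable (h : IsNoise μ δ) {A : Set (ℕ × ℕ)} {i j : ℕ} (hp : (i, j) ∉ A)
    {Z : Ω → ℝ} (hZ : Measurable[errorSigma δ A] Z) : IndepFun Z (δ i j) μ := by
  have h1 := indep_iSup_of_disjoint (fun p : ℕ × ℕ => (h.meas p.1 p.2).comap_le) h.indep.iIndep
    (S := A) (T := {(i, j)}) (Set.disjoint_singleton_right.2 hp)
  rw [iSup_singleton] at h1
  rw [IndepFun_iff_Indep]
  exact indep_of_indep_of_le_left h1 hZ.comap_le

lemma integral_mul_eq_zero (h : IsNoise μ δ) {A : Set (ℕ × ℕ)} {i j : ℕ} (hp : (i, j) ∉ A)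
    {Z : Ω → ℝ} (hZ : Measurable[errorSigma δ A] Z) : ∫ ω, Z ω * δ i j ω ∂μ = 0 := by
  rw [(h.indepFun_of_measurable hp hZ).integral_fun_mul_eq_mul_integral
    (hZ.mono (h.errorSigma_le A) le_rfl).aestronglyMeasurable
    (h.meas i j).aestronglyMeasurable, h.mean, mul_zero]

/-- The variance of the errors. -/
noncomputable def errorVar (μ : Measure Ω) (δ : ℕ → ℕ → Ω → ℝ) : ℝ := ∫ ω, δ 0 0 ω ^ 2 ∂μ

lemma integral_sq (h : IsNoise μ δ) (i j : ℕ) : ∫ ω, δ i j ω ^ 2 ∂μ = errorVar μ δ :=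
  ((h.ident i j).comp (measurable_id.pow_const 2)).integral_eq

lemma errorVar_nonneg : 0 ≤ errorVar μ δ := integral_nonneg fun _ => sq_nonneg _

variable [IsProbabilityMeasure μ]

lemma integrable_sq (h : IsNoise μ δ) (i j : ℕ) : Integrable (fun ω => δ i j ω ^ 2) μ :=
  (h.memLp i j).integrable_sq

lemma memLp_errorSum (h : IsNoise μ δ) (j n : ℕ) : MemLp (errorSum δ j n) 2 μ :=
  memLp_finsetSum _ fun i _ => h.memLp i j

/-- The two factors are independent, so their squares have an integrable product without any fourth
moment. -/
lemma memLp_errorSum_mul (h : IsNoise μ δ) (j n : ℕ) :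
    MemLp (fun ω => errorSum δ j n ω * δ n j ω) 2 μ := by
  have hS := h.memLp_errorSum j n
  have haes : AEStronglyMeasurable (fun ω => errorSum δ j n ω * δ n j ω) μ :=
    hS.1.mul (h.memLp n j).1
  rw [memLp_two_iff_integrable_sq haes]
  have hind : IndepFun (errorSum δ j n) (δ n j) μ :=
    h.indepFun_of_measurable (A := {p | p.1 < n}) (by simp)
      (measurable_errorSum_sigma δ fun i hi => hi)
  have := (hind.comp (measurable_id.pow_const 2) (measurable_id.pow_const 2)).integrable_mul
    hS.integrable_sq (h.integrable_sq n j)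
  refine this.congr (ae_of_all _ fun ω => ?_)
  simp [mul_pow]

lemma memLp_errorIncr (h : IsNoise μ δ) (m n : ℕ) : MemLp (errorIncr δ m n) 2 μ :=
  memLp_finsetSum _ fun j _ => (h.memLp_errorSum_mul j n).const_mul 2

lemma memLp_errorMart (h : IsNoise μ δ) (m n : ℕ) : MemLp (errorMart δ m n) 2 μ := by
  induction n with
  | zero =>
    have : errorMart δ m 0 = fun _ => 0 := by
      funext ω; simp [errorMart, errorSum]
    rw [this]
    exact MemLp.zero'
  | succ n ih =>
    have : errorMart δ m (n + 1) = errorMart δ m n + errorIncr δ m n := by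
      funext ω; exact errorMart_succ δ m n ω
    rw [this]
    exact ih.add (h.memLp_errorIncr m n)

lemma integral_errorSum_sq (h : IsNoise μ δ) (j n : ℕ) :
    ∫ ω, errorSum δ j n ω ^ 2 ∂μ = n * errorVar μ δ := by
  induction n with
  | zero => simp [errorSum]
  | succ n ih =>
    have h1 : ∀ ω, errorSum δ j (n + 1) ω ^ 2
        = errorSum δ j n ω ^ 2 + 2 * (errorSum δ j n ω * δ n j ω) + δ n j ω ^ 2 := by
      intro ω; rw [errorSum_succ]; ring
    have h0 : ∫ ω, errorSum δ j n ω * δ n j ω ∂μ = 0 :=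
      h.integral_mul_eq_zero (A := {p | p.1 < n}) (by simp)
        (measurable_errorSum_sigma δ fun i hi => hi)
    have hi1 := (h.memLp_errorSum j n).integrable_sq
    have hi2 := ((h.memLp_errorSum_mul j n).integrable one_le_two).const_mul 2
    have hi12 : Integrable (fun ω => errorSum δ j n ω ^ 2 + 2 * (errorSum δ j n ω * δ n j ω)) μ :=
      hi1.add hi2
    simp_rw [h1]
    rw [integral_add hi12 (h.integrable_sq n j), integral_add hi1 hi2,
      integral_const_mul, h0, ih, h.integral_sq]
    push_cast; ring

lemma integral_errorSum_mul_mul (h : IsNoise μ δ) (n j j' : ℕ) :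
    ∫ ω, (errorSum δ j n ω * δ n j ω) * (errorSum δ j' n ω * δ n j' ω) ∂μ
      = if j = j' then n * errorVar μ δ ^ 2 else 0 := by
  split_ifs with hj
  · subst hj
    have hind : IndepFun (errorSum δ j n) (δ n j) μ :=
      h.indepFun_of_measurable (A := {p | p.1 < n}) (by simp)
        (measurable_errorSum_sigma δ fun i hi => hi)
    have h2 := (hind.comp (φ := fun x : ℝ => x ^ 2) (ψ := fun x : ℝ => x ^ 2)
      (measurable_id.pow_const 2)
      (measurable_id.pow_const 2)).integral_fun_mul_eq_mul_integral
      (by exact (h.memLp_errorSum j n).1.pow 2) (by exact (h.memLp n j).1.pow 2)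
    simp only [Function.comp_apply] at h2
    rw [h.integral_errorSum_sq, h.integral_sq] at h2
    calc _ = ∫ ω, errorSum δ j n ω ^ 2 * δ n j ω ^ 2 ∂μ := by
          congr 1; funext ω; ring
      _ = _ := by rw [h2]; ring
  -- The single error `(n, j')` is independent of the remaining factors, which involve other indices
  -- only, and it is centred.
  · have := h.integral_mul_eq_zero (A := {p | p ≠ (n, j')}) (i := n) (j := j') (by simp)
      (Z := fun ω => (errorSum δ j n ω * δ n j ω) * errorSum δ j' n ω) (by
        refine Measurable.mul (Measurable.mul ?_ ?_) ?_
        · exact measurable_errorSum_sigma δ fun i hi => by simp [hj]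
        · exact measurable_errorSigma δ (by simp [hj])
        · exact measurable_errorSum_sigma δ fun i hi => by simp [hi.ne])
    rw [← this]
    congr 1; funext ω; ring

lemma integral_errorIncr_sq (h : IsNoise μ δ) (m n : ℕ) :
    ∫ ω, errorIncr δ m n ω ^ 2 ∂μ = 4 * m * n * errorVar μ δ ^ 2 := by
  have h1 : ∀ ω, errorIncr δ m n ω ^ 2 = ∑ j ∈ Finset.range m, ∑ j' ∈ Finset.range m,
      4 * ((errorSum δ j n ω * δ n j ω) * (errorSum δ j' n ω * δ n j' ω)) := by
    intro ω
    rw [errorIncr, sq, Finset.sum_mul_sum]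
    exact Finset.sum_congr rfl fun j _ => Finset.sum_congr rfl fun j' _ => by ring
  have hint : ∀ j j', Integrable (fun ω =>
      4 * ((errorSum δ j n ω * δ n j ω) * (errorSum δ j' n ω * δ n j' ω))) μ := fun j j' =>
    ((h.memLp_errorSum_mul j n).integrable_mul (h.memLp_errorSum_mul j' n)).const_mul 4
  simp_rw [h1]
  rw [integral_finsetSum _ fun j _ => integrable_finsetSum _ fun j' _ => hint j j']
  have h2 : ∀ j ∈ Finset.range m, ∫ ω, ∑ j' ∈ Finset.range m,
      4 * ((errorSum δ j n ω * δ n j ω) * (errorSum δ j' n ω * δ n j' ω)) ∂μ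
      = 4 * (n * errorVar μ δ ^ 2) := by
    intro j hj
    rw [integral_finsetSum _ fun j' _ => hint j j']
    simp_rw [integral_const_mul, h.integral_errorSum_mul_mul]
    rw [← Finset.mul_sum, Finset.sum_ite_eq, if_pos hj]
  rw [Finset.sum_congr rfl h2, Finset.sum_const, Finset.card_range, nsmul_eq_mul]
  ring

/-- The filtration generated by the repetitions. -/
def errorFiltration (h : IsNoise μ δ) : Filtration ℕ mΩ where
  seq n := errorSigma δ {p | p.1 < n}
  mono' _ _ hab := errorSigma_mono δ fun _ hp => lt_of_lt_of_le hp hab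
  le' _ := h.errorSigma_le _

lemma setIntegral_errorMart_mul_errorIncr (h : IsNoise μ δ) (m n : ℕ) {s : Set Ω}
    (hs : MeasurableSet[errorSigma δ {p | p.1 < n}] s) :
    ∫ ω in s, errorMart δ m n ω * errorIncr δ m n ω ∂μ = 0 := by
  have hs' : MeasurableSet s := h.errorSigma_le _ s hs
  have h1 : ∀ ω, errorMart δ m n ω * errorIncr δ m n ω = ∑ j ∈ Finset.range m,
      2 * (errorMart δ m n ω * (errorSum δ j n ω * δ n j ω)) := by
    intro ω
    rw [errorIncr, Finset.mul_sum]
    exact Finset.sum_congr rfl fun j _ => by ring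
  simp_rw [h1]
  rw [integral_finsetSum]
  · refine Finset.sum_eq_zero fun j _ => ?_
    rw [integral_const_mul, ← integral_indicator hs']
    have h2 := h.integral_mul_eq_zero (A := {p | p.1 < n}) (i := n) (j := j) (by simp)
      (Z := s.indicator fun ω => errorMart δ m n ω * errorSum δ j n ω) (by
        refine Measurable.indicator (Measurable.mul ?_ ?_) hs
        · exact measurable_errorMart_sigma δ fun i hi _ _ => hi
        · exact measurable_errorSum_sigma δ fun i hi => hi)
    have h3 : (s.indicator fun ω => errorMart δ m n ω * (errorSum δ j n ω * δ n j ω))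
        = fun ω => s.indicator (fun ω => errorMart δ m n ω * errorSum δ j n ω) ω * δ n j ω := by
      funext ω
      by_cases hω : ω ∈ s
      · simp only [Set.indicator_of_mem hω]; ring
      · simp only [Set.indicator_of_notMem hω, zero_mul]
    rw [h3, h2, mul_zero]
  · intro j _
    exact (((h.memLp_errorMart m n).integrable_mul
      (h.memLp_errorSum_mul j n)).const_mul 2).integrableOn

/-- Orthogonality of martingale increments, over sets of the past: `univ` gives the variance
recursion, general `s` the submartingale property. -/
lemma setIntegral_errorMart_sq_succ (h : IsNoise μ δ) (m n : ℕ) {s : Set Ω}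
    (hs : MeasurableSet[errorSigma δ {p | p.1 < n}] s) :
    ∫ ω in s, errorMart δ m (n + 1) ω ^ 2 ∂μ
      = ∫ ω in s, errorMart δ m n ω ^ 2 ∂μ + ∫ ω in s, errorIncr δ m n ω ^ 2 ∂μ := by
  have h1 : ∀ ω, errorMart δ m (n + 1) ω ^ 2
      = errorMart δ m n ω ^ 2 + 2 * (errorMart δ m n ω * errorIncr δ m n ω)
        + errorIncr δ m n ω ^ 2 := by
    intro ω; rw [errorMart_succ]; ring
  have hi1 := (h.memLp_errorMart m n).integrable_sq.integrableOn (s := s)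
  have hi2 : IntegrableOn (fun ω => 2 * (errorMart δ m n ω * errorIncr δ m n ω)) s μ :=
    (((h.memLp_errorMart m n).integrable_mul (h.memLp_errorIncr m n)).const_mul 2).integrableOn
  have hi12 : IntegrableOn (fun ω => errorMart δ m n ω ^ 2
      + 2 * (errorMart δ m n ω * errorIncr δ m n ω)) s μ := hi1.add hi2
  have hi3 := (h.memLp_errorIncr m n).integrable_sq.integrableOn (s := s)
  simp_rw [h1]
  rw [integral_add hi12 hi3, integral_add hi1 hi2, integral_const_mul,
    h.setIntegral_errorMart_mul_errorIncr m n hs]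
  ring

lemma integral_errorMart_sq_le (h : IsNoise μ δ) (m n : ℕ) :
    ∫ ω, errorMart δ m n ω ^ 2 ∂μ ≤ 2 * m * n ^ 2 * errorVar μ δ ^ 2 := by
  induction n with
  | zero => simp [errorMart, errorSum]
  | succ n ih =>
    have h1 := h.setIntegral_errorMart_sq_succ m n MeasurableSet.univ
    rw [setIntegral_univ, setIntegral_univ, setIntegral_univ, h.integral_errorIncr_sq] at h1
    rw [h1]
    push_cast
    have : 0 ≤ (m : ℝ) * errorVar μ δ ^ 2 := by positivity
    nlinarith

lemma submartingale_errorMart_sq (h : IsNoise μ δ) (m : ℕ) :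
    Submartingale (fun n ω => errorMart δ m n ω ^ 2) h.errorFiltration μ := by
  refine submartingale_of_setIntegral_le_succ (fun n => ?_)
    (fun n => (h.memLp_errorMart m n).integrable_sq) fun n s hs => ?_
  · exact ((measurable_errorMart_sigma δ fun i hi _ _ => hi).pow_const 2).stronglyMeasurable
  · rw [h.setIntegral_errorMart_sq_succ m n hs]
    exact le_add_of_nonneg_right (integral_nonneg fun _ => sq_nonneg _)

/-- Doob's maximal inequality for the martingale of the off-diagonal products. -/
lemma measure_exists_errorMart_le (h : IsNoise μ δ) (m N : ℕ) {a : ℝ} (ha : 0 < a) :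
    μ {ω | ∃ n ≤ N, a ≤ |errorMart δ m n ω|}
      ≤ ENNReal.ofReal (2 * m * N ^ 2 * errorVar μ δ ^ 2 / a ^ 2) := by
  have hε : 0 < a ^ 2 := by positivity
  have h1 := maximal_ineq (h.submartingale_errorMart_sq m) (fun n ω => sq_nonneg _)
    (ε := ⟨a ^ 2, hε.le⟩) N
  set T := {ω | ((⟨a ^ 2, hε.le⟩ : NNReal) : ℝ) ≤ (Finset.range (N + 1)).sup'
    Finset.nonempty_range_add_one fun k => errorMart δ m k ω ^ 2} with hT
  have hsub : {ω | ∃ n ≤ N, a ≤ |errorMart δ m n ω|} ⊆ T := by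
    rintro ω ⟨n, hn, hω⟩
    change a ^ 2 ≤ _
    refine le_trans ?_ (Finset.le_sup' (fun k => errorMart δ m k ω ^ 2)
      (Finset.mem_range.2 (Nat.lt_succ_of_le hn)))
    rw [← sq_abs (errorMart δ m n ω)]
    gcongr
  have h2 : ∫ ω in T, errorMart δ m N ω ^ 2 ∂μ ≤ 2 * m * N ^ 2 * errorVar μ δ ^ 2 :=
    (setIntegral_le_integral (h.memLp_errorMart m N).integrable_sq
      (ae_of_all _ fun _ => sq_nonneg _)).trans (h.integral_errorMart_sq_le m N)
  refine (measure_mono hsub).trans ?_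
  have h3 : ENNReal.ofNNReal ⟨a ^ 2, hε.le⟩ = ENNReal.ofReal (a ^ 2) :=
    (ENNReal.ofReal_eq_coe_nnreal hε.le).symm
  rw [h3] at h1
  rw [ENNReal.ofReal_div_of_pos hε,
    ENNReal.le_div_iff_mul_le (Or.inl (ENNReal.ofReal_pos.2 hε).ne') (Or.inl ENNReal.ofReal_ne_top),
    mul_comm]
  exact h1.trans (ENNReal.ofReal_le_ofReal h2)

end IsNoise

end Noise

/-! ### Probability bounds at the data-driven number of repetitions. -/

section NoiseBounds

variable {Ω : Type*} [mΩ : MeasurableSpace Ω] {μ : Measure Ω} {δ : ℕ → ℕ → Ω → ℝ}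

lemma measure_le_integral_div [IsFiniteMeasure μ] {f : Ω → ℝ} (hf : Integrable f μ)
    (h0 : ∀ ω, 0 ≤ f ω) {t : ℝ} (ht : 0 < t) :
    μ {ω | t ≤ f ω} ≤ ENNReal.ofReal ((∫ ω, f ω ∂μ) / t) := by
  rw [← ofReal_measureReal]
  refine ENNReal.ofReal_le_ofReal ?_
  rw [le_div_iff₀ ht, mul_comm]
  exact mul_meas_ge_le_integral_of_nonneg (ae_of_all _ h0) hf t

/-- The bounded truncation `min (x², 1)` of the square. -/
noncomputable def truncSq (x : ℝ) : ℝ := min (x ^ 2) 1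

lemma measurable_truncSq : Measurable truncSq :=
  (measurable_id.pow_const 2).min measurable_const

lemma truncSq_nonneg (x : ℝ) : 0 ≤ truncSq x := le_min (sq_nonneg x) zero_le_one

lemma truncSq_le_one (x : ℝ) : truncSq x ≤ 1 := min_le_right _ _

lemma truncSq_le_sq (x : ℝ) : truncSq x ≤ x ^ 2 := min_le_left _ _

/-- The mean of the truncated squared errors. -/
noncomputable def truncMean (μ : Measure Ω) (δ : ℕ → ℕ → Ω → ℝ) : ℝ :=
  ∫ ω, truncSq (δ 0 0 ω) ∂μ

lemma truncMean_nonneg : 0 ≤ truncMean μ δ := integral_nonneg fun _ => truncSq_nonneg _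

namespace IsNoise

variable [IsProbabilityMeasure μ]

lemma memLp_truncSq (h : IsNoise μ δ) (i j : ℕ) : MemLp (fun ω => truncSq (δ i j ω)) 2 μ := by
  refine MemLp.of_bound (measurable_truncSq.comp (h.meas i j)).aestronglyMeasurable 1
    (ae_of_all _ fun ω => ?_)
  rw [Real.norm_of_nonneg (truncSq_nonneg _)]
  exact truncSq_le_one _

lemma integral_truncSq (h : IsNoise μ δ) (i j : ℕ) :
    ∫ ω, truncSq (δ i j ω) ∂μ = truncMean μ δ :=
  ((h.ident i j).comp measurable_truncSq).integral_eq

lemma variance_truncSq_le (h : IsNoise μ δ) (i j : ℕ) :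
    variance (fun ω => truncSq (δ i j ω)) μ ≤ 1 := by
  refine (variance_le_expectation_sq (h.memLp_truncSq i j).1).trans ?_
  have h1 : ∫ ω, (fun ω => truncSq (δ i j ω)) ω ^ 2 ∂μ ≤ ∫ _, (1 : ℝ) ∂μ := by
    refine integral_mono (h.memLp_truncSq i j).integrable_sq (integrable_const _) fun ω => ?_
    exact pow_le_one₀ (truncSq_nonneg _) (truncSq_le_one _)
  simpa using h1

/-- Chebyshev's inequality for the truncated squared errors. -/
lemma measure_sum_truncSq_le (h : IsNoise μ δ) {m n : ℕ} (hm : 1 ≤ m) (hn : 1 ≤ n)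
    (ha : 0 < truncMean μ δ) :
    μ {ω | ∑ j ∈ Finset.range m, ∑ i ∈ Finset.range n, truncSq (δ i j ω)
        ≤ n * m * truncMean μ δ / 2}
      ≤ ENNReal.ofReal (4 / (n * m * truncMean μ δ ^ 2)) := by
  set a := truncMean μ δ
  set s := Finset.range n ×ˢ Finset.range m with hs
  set X : ℕ × ℕ → Ω → ℝ := fun p ω => truncSq (δ p.1 p.2 ω) with hX
  have hm0 : (0 : ℝ) < m := by positivity
  have hn0 : (0 : ℝ) < n := by positivity
  have hmem : ∀ p, MemLp (X p) 2 μ := fun p => h.memLp_truncSq p.1 p.2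
  have hind : iIndepFun X μ :=
    h.indep.comp (fun _ => truncSq) fun _ => measurable_truncSq
  have hvar : variance (∑ p ∈ s, X p) μ ≤ n * m := by
    rw [IndepFun.variance_sum (fun p _ => hmem p) fun p _ p' _ hne => hind.indepFun hne]
    refine (Finset.sum_le_card_nsmul s _ 1 fun p _ => h.variance_truncSq_le p.1 p.2).trans ?_
    simp [hs]
  have hmean : ∫ ω, (∑ p ∈ s, X p) ω ∂μ = n * m * a := by
    simp only [Finset.sum_apply]
    rw [integral_finsetSum _ fun p _ => (hmem p).integrable one_le_two]
    simp only [hX, h.integral_truncSq]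
    simp [hs, a]
  have hc : 0 < n * m * a / 2 := by positivity
  have hcheb := meas_ge_le_variance_div_sq (memLp_finsetSum' s fun p _ => hmem p) hc
  rw [hmean] at hcheb
  refine (measure_mono fun ω hω => ?_).trans (hcheb.trans (ENNReal.ofReal_le_ofReal ?_))
  · have h1 : (∑ p ∈ s, X p) ω
        = ∑ j ∈ Finset.range m, ∑ i ∈ Finset.range n, truncSq (δ i j ω) := by
      rw [Finset.sum_apply, hs, Finset.sum_product, Finset.sum_comm]
    have h2 : (∑ p ∈ s, X p) ω ≤ n * m * a / 2 := h1 ▸ hω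
    change n * m * a / 2 ≤ |(∑ p ∈ s, X p) ω - n * m * a|
    rw [abs_sub_comm]
    refine le_trans ?_ (le_abs_self _)
    linarith
  · calc variance (∑ p ∈ s, X p) μ / (n * m * a / 2) ^ 2
        ≤ n * m / (n * m * a / 2) ^ 2 := by gcongr
      _ = 4 / (n * m * a ^ 2) := by field_simp; norm_num

/-- With high probability the pooled sample variance is bounded below, for all numbers of
repetitions simultaneously. -/
lemma measure_exists_errorDev_lt (h : IsNoise μ δ) (ha : 0 < truncMean μ δ) :
    ∃ B : ℝ, 0 ≤ B ∧ ∀ m : ℕ, 1 ≤ m →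
      μ {ω | ∃ n : ℕ, 2 ≤ n ∧ errorDev δ m n ω < (n - 1) * (m * (truncMean μ δ / 8))}
        ≤ ENNReal.ofReal (B / m) := by
  set a := truncMean μ δ
  set s := errorVar μ δ
  set B₀ : ℝ := 4 / a ^ 2 + 32 * s ^ 2 / a ^ 2 with hB₀
  have hB₀0 : 0 ≤ B₀ := by positivity
  refine ⟨2 * B₀, by positivity, fun m hm => ?_⟩
  have hm0 : (0 : ℝ) < m := by positivity
  -- Exceptional events for `N = 2^(k+1)`. Outside them `N W = (N - 1) Q - M` exceeds `N (N - 1) m a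
  -- (1/2 - 1/4)`. Their probabilities decay like `2^(-k) / m`, so a union over `k` is affordable.
  set U : ℕ → Set Ω := fun k =>
    {ω | ∑ j ∈ Finset.range m, ∑ i ∈ Finset.range (2 ^ (k + 1)), truncSq (δ i j ω)
        ≤ ((2 ^ (k + 1) : ℕ) : ℝ) * m * a / 2} ∪
    {ω | ∃ n ≤ 2 ^ (k + 1), ((2 : ℝ) ^ (k + 1)) * (2 ^ (k + 1) - 1) * m * a / 4
        ≤ |errorMart δ m n ω|} with hU
  have hUle : ∀ k, μ (U k) ≤ ENNReal.ofReal (B₀ / m * (1 / 2) ^ k) := by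
    intro k
    have hp : (1 : ℝ) ≤ 2 ^ k := one_le_pow₀ one_le_two
    have hp1 : (2 : ℝ) ^ (k + 1) = 2 * 2 ^ k := by ring
    have hp2 : (0 : ℝ) < 2 ^ (k + 1) - 1 := by linarith
    refine (measure_union_le _ _).trans ?_
    refine (add_le_add (h.measure_sum_truncSq_le hm Nat.one_le_two_pow ha)
      (h.measure_exists_errorMart_le m (2 ^ (k + 1)) (by positivity))).trans ?_
    rw [← ENNReal.ofReal_add (by positivity) (by positivity)]
    refine ENNReal.ofReal_le_ofReal ?_
    push_cast
    have e1 : 4 / ((2 : ℝ) ^ (k + 1) * m * a ^ 2) ≤ 4 / a ^ 2 / m * (1 / 2) ^ k := by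
      rw [one_div, inv_pow, div_div, ← div_eq_mul_inv, div_div]
      refine div_le_div_of_nonneg_left (by norm_num) (by positivity) ?_
      rw [hp1]
      have : 0 < a ^ 2 * m * 2 ^ k := by positivity
      linarith
    have e2 : 2 * m * ((2 : ℝ) ^ (k + 1)) ^ 2 * s ^ 2
        / (2 ^ (k + 1) * (2 ^ (k + 1) - 1) * m * a / 4) ^ 2
        ≤ 32 * s ^ 2 / a ^ 2 / m * (1 / 2) ^ k := by
      have e3 : 2 * m * ((2 : ℝ) ^ (k + 1)) ^ 2 * s ^ 2
          / (2 ^ (k + 1) * (2 ^ (k + 1) - 1) * m * a / 4) ^ 2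
          = 32 * s ^ 2 / (a ^ 2 * m * (2 ^ (k + 1) - 1) ^ 2) := by
        have := hp2.ne'
        field_simp
        ring
      rw [e3, one_div, inv_pow, div_div, ← div_eq_mul_inv, div_div]
      refine div_le_div_of_nonneg_left (by positivity) (by positivity) ?_
      refine mul_le_mul_of_nonneg_left ?_ (by positivity)
      nlinarith
    calc _ ≤ _ := add_le_add e1 e2
      _ = _ := by rw [hB₀]; ring
  have hsub : {ω | ∃ n : ℕ, 2 ≤ n ∧ errorDev δ m n ω < (n - 1) * (m * (a / 8))} ⊆ ⋃ k, U k := by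
    rintro ω ⟨n, hn, hlt⟩
    rw [Set.mem_iUnion]
    by_contra! hnot
    obtain ⟨k, hk1, hk2⟩ : ∃ k, 2 ^ (k + 1) ≤ n ∧ n < 2 ^ (k + 2) := by
      refine ⟨Nat.log 2 n - 1, ?_, ?_⟩
      · have h1 : 1 ≤ Nat.log 2 n := Nat.log_pos one_lt_two hn
        rw [Nat.sub_add_cancel h1]
        exact Nat.pow_log_le_self 2 (by omega)
      · have h1 : 1 ≤ Nat.log 2 n := Nat.log_pos one_lt_two hn
        have h2 := Nat.lt_pow_succ_log_self one_lt_two n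
        rwa [show Nat.log 2 n - 1 + 2 = (Nat.log 2 n).succ by omega]
    have hk := hnot k
    rw [hU] at hk
    simp only [Set.mem_union, not_or, Set.mem_ofPred_eq, not_le, not_exists, not_and] at hk
    obtain ⟨hk3, hk4⟩ := hk
    have hk5 := hk4 _ le_rfl
    set N : ℕ := 2 ^ (k + 1) with hN
    have hNr : ((2 : ℝ) ^ (k + 1)) = N := by rw [hN]; push_cast; rfl
    rw [hNr] at hk5
    have hN2 : (2 : ℝ) ≤ N := by
      rw [← hNr, pow_succ]
      have : (1 : ℝ) ≤ 2 ^ k := one_le_pow₀ one_le_two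
      linarith
    have hnN : (n : ℝ) + 1 ≤ 2 * N := by
      have : n + 1 ≤ 2 * N := by rw [hN]; rw [pow_succ] at hk2; omega
      exact_mod_cast this
    have hdev := mul_errorDev δ m (n := N) Nat.one_le_two_pow ω
    have hmono := errorDev_mono δ m Nat.one_le_two_pow hk1 ω
    have hQ : ∑ j ∈ Finset.range m, ∑ i ∈ Finset.range N, truncSq (δ i j ω)
        ≤ errorSq δ m N ω :=
      Finset.sum_le_sum fun j _ => Finset.sum_le_sum fun i _ => truncSq_le_sq _
    have hQ2 : N * m * a / 2 < errorSq δ m N ω := hk3.trans_le hQ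
    have hN1 : (0 : ℝ) < N - 1 := by linarith
    have hM := (le_abs_self _).trans_lt hk5
    have h1 : (N : ℝ) * ((N - 1) * m * a / 4) < N * errorDev δ m N ω := by
      rw [hdev]
      have := mul_lt_mul_of_pos_left hQ2 hN1
      linarith
    have h2 := lt_of_mul_lt_mul_left h1 (by linarith : (0 : ℝ) ≤ N)
    -- From `n ≤ 2N - 1` comes `n - 1 ≤ 2 (N - 1)`; this is the loss from `a / 4` to `a / 8`.
    have h3 : (n - 1) * (m * (a / 8)) ≤ (N - 1) * m * a / 4 := by
      have : 0 < m * (a / 8) := by positivity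
      nlinarith
    linarith
  refine (measure_mono hsub).trans ((measure_iUnion_le _).trans ?_)
  refine (ENNReal.tsum_le_tsum hUle).trans ?_
  have hsum : Summable fun k : ℕ => B₀ / m * (1 / 2 : ℝ) ^ k :=
    summable_geometric_two.mul_left _
  rw [← ENNReal.ofReal_tsum_of_nonneg (fun k => by positivity) hsum]
  refine ENNReal.ofReal_le_ofReal ?_
  rw [tsum_mul_left, tsum_geometric_two]
  exact le_of_eq (by ring)

lemma integral_errorSq (h : IsNoise μ δ) (m n : ℕ) :
    Integrable (errorSq δ m n) μ ∧ ∫ ω, errorSq δ m n ω ∂μ = m * n * errorVar μ δ := by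
  have hint : ∀ j, Integrable (fun ω => ∑ i ∈ Finset.range n, δ i j ω ^ 2) μ := fun j =>
    integrable_finsetSum _ fun i _ => h.integrable_sq i j
  refine ⟨integrable_finsetSum _ fun j _ => hint j, ?_⟩
  simp only [errorSq]
  rw [integral_finsetSum _ fun j _ => hint j]
  have : ∀ j ∈ Finset.range m, ∫ ω, ∑ i ∈ Finset.range n, δ i j ω ^ 2 ∂μ = n * errorVar μ δ := by
    intro j _
    rw [integral_finsetSum _ fun i _ => h.integrable_sq i j]
    simp [h.integral_sq]
  rw [Finset.sum_congr rfl this]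
  simp
  ring

/-- Some number of repetitions up to an explicit bound is admissible with high probability. -/
lemma measure_errorDev_gt_le (h : IsNoise μ δ) {C κ : ℝ} (hC : 0 < C) (hκ : 0 < κ) {m N : ℕ}
    (hN2 : 2 ≤ N) (hN : C * m * errorVar μ δ / κ ≤ N - 1) :
    μ {ω | κ * (N * (N - 1)) < errorDev δ m N ω} ≤ ENNReal.ofReal (1 / C) := by
  have hN2' : (2 : ℝ) ≤ N := by exact_mod_cast hN2
  have hN1 : (0 : ℝ) < N - 1 := by linarith
  have hN0 : (0 : ℝ) < N := by linarith
  have ht : 0 < κ * (N * (N - 1)) := by positivity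
  obtain ⟨hint, hval⟩ := h.integral_errorSq m N
  have hnn : ∀ ω, 0 ≤ errorSq δ m N ω := fun ω =>
    Finset.sum_nonneg fun j _ => Finset.sum_nonneg fun i _ => sq_nonneg _
  refine (measure_mono fun ω hω => ?_).trans ((measure_le_integral_div hint hnn ht).trans
    (ENNReal.ofReal_le_ofReal ?_))
  · exact (le_of_lt hω).trans (errorDev_le_errorSq δ m N ω)
  · rw [hval, div_le_div_iff₀ ht hC]
    rw [div_le_iff₀ hκ] at hN
    nlinarith

/-- Settles the degenerate case in which the sample variance has no positive lower bound. -/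
lemma ae_eq_zero_of_truncMean_eq_zero (h : IsNoise μ δ) (ha : truncMean μ δ = 0) :
    ∀ᵐ ω ∂μ, ∀ i j, δ i j ω = 0 := by
  rw [ae_all_iff]
  intro i
  rw [ae_all_iff]
  intro j
  have h1 := h.integral_truncSq i j
  rw [ha, integral_eq_zero_iff_of_nonneg (fun ω => truncSq_nonneg _)
    ((h.memLp_truncSq i j).integrable one_le_two)] at h1
  filter_upwards [h1] with ω hω
  have h2 : truncSq (δ i j ω) = 0 := hω
  rw [truncSq] at h2
  rcases min_choice (δ i j ω ^ 2) 1 with h3 | h3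
  · rw [h3] at h2
    exact pow_eq_zero_iff two_ne_zero |>.1 h2
  · rw [h3] at h2
    exact absurd h2 one_ne_zero

end IsNoise

/-- The numbers of repetitions meeting the stopping criterion, in terms of the errors. -/
def stoppingSet (δ : ℕ → ℕ → Ω → ℝ) (m : ℕ) (κ : ℝ) (ω : Ω) : Set ℕ :=
  {n | 2 ≤ n ∧ errorDev δ m n ω ≤ κ * (n * (n - 1))}

/-- The deterministic core. Stopping and the lower bound on the deviation force `m c₀ ≤ κ n`, so `N`
is at most a constant times `n`, and a martingale of size `ε m N` is at most `θ κ n (n - 1)`. -/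
lemma noise_le_of_good {m N n : ℕ} {ω : Ω} {κ θ c₀ b ε : ℝ} (hθ : 0 < θ) (hc₀ : 0 < c₀)
    (hκ : 0 < κ) (hb : 0 ≤ b) (hn : n ∈ stoppingSet δ m κ ω)
    (hN : (N : ℝ) ≤ b * m / κ + 3) (hε : ε = θ * c₀ / (2 * (b / c₀ + 2)))
    (hL : (n - 1) * (m * c₀) ≤ errorDev δ m n ω) (hM : |errorMart δ m n ω| ≤ ε * (m * N)) :
    ∑ j ∈ Finset.range m, errorSum δ j n ω ^ 2 ≤ (1 + θ) * κ * n ^ 2 := by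
  obtain ⟨hn2, hW⟩ := hn
  have hn2' : (2 : ℝ) ≤ n := by exact_mod_cast hn2
  have hn1 : (0 : ℝ) < n - 1 := by linarith
  have hm0 : (0 : ℝ) ≤ m := by positivity
  have h1 : m * c₀ ≤ κ * n := by
    refine le_of_mul_le_mul_left ?_ hn1
    linarith
  have hN' : (N : ℝ) ≤ (b / c₀ + 2) * n := by
    have : b * m / κ ≤ b / c₀ * n := by
      rw [div_mul_eq_mul_div, div_le_div_iff₀ hκ hc₀]
      nlinarith
    linarith
  have hε0 : 0 ≤ ε := by rw [hε]; positivity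
  have h2 : errorMart δ m n ω ≤ θ * κ * (n * (n - 1)) := by
    calc errorMart δ m n ω ≤ ε * (m * N) := (le_abs_self _).trans hM
      _ ≤ ε * (m * ((b / c₀ + 2) * n)) := by gcongr
      _ = θ * n / 2 * (m * c₀) := by rw [hε]; field_simp
      _ ≤ θ * n / 2 * (κ * n) := by gcongr
      -- Here `n ≥ 2` is used in the form `n / 2 ≤ n - 1`.
      _ ≤ θ * κ * (n * (n - 1)) := by
        have : 0 < θ * κ * n := by positivity
        nlinarith
  have h3 := mul_errorDev δ m (n := n) (by omega) ω
  rw [sum_errorSum_sq]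
  refine le_of_mul_le_mul_left ?_ hn1
  have h4 : (n - 1) * (errorMart δ m n ω + errorSq δ m n ω)
      = n * (errorDev δ m n ω + errorMart δ m n ω) := by linarith
  rw [h4]
  have h5 : (n : ℝ) * (errorDev δ m n ω + errorMart δ m n ω)
      ≤ n * (κ * (n * (n - 1)) + θ * κ * (n * (n - 1))) := by gcongr
  linarith

namespace IsNoise

variable [IsProbabilityMeasure μ]

/-- The averaged error at the data-driven number of repetitions exceeds the prescribed level
only with small probability. -/
theorem measure_noise_gt_le (h : IsNoise μ δ) {θ : ℝ} (hθ : 0 < θ) {C : ℝ} (hC : 0 < C) :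
    ∃ A : ℝ, 0 ≤ A ∧ ∀ m : ℕ, 1 ≤ m → ∀ κ : ℝ, 0 < κ →
      μ {ω | (1 + θ) * κ * (sInf (stoppingSet δ m κ ω) : ℕ) ^ 2
          < ∑ j ∈ Finset.range m, errorSum δ j (sInf (stoppingSet δ m κ ω)) ω ^ 2}
        ≤ ENNReal.ofReal (1 / C + A / m) := by
  rcases (truncMean_nonneg (μ := μ) (δ := δ)).eq_or_lt with ha | ha
  · refine ⟨0, le_rfl, fun m hm κ hκ => ?_⟩
    have hnull : μ {ω | ¬ ∀ i j, δ i j ω = 0} = 0 := h.ae_eq_zero_of_truncMean_eq_zero ha.symm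
    refine (measure_mono_null (fun ω hω => ?_) hnull).trans_le zero_le
    intro hzero
    rw [Set.mem_ofPred_eq] at hω
    refine absurd hω (not_lt.2 ?_)
    have : ∀ j n, errorSum δ j n ω = 0 := fun j n => Finset.sum_eq_zero fun i _ => hzero i j
    simp only [this]
    simp
    positivity
  · obtain ⟨B, hB, hL⟩ := h.measure_exists_errorDev_lt ha
    set s := errorVar μ δ with hs
    have hs0 : 0 ≤ s := errorVar_nonneg
    set c₀ := truncMean μ δ / 8 with hc₀
    have hc₀0 : 0 < c₀ := by positivity
    set b := C * s with hb
    have hb0 : 0 ≤ b := by positivity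
    set ε := θ * c₀ / (2 * (b / c₀ + 2)) with hε
    have hε0 : 0 < ε := by positivity
    -- The constant must not depend on `κ`, which will vary with `m`. In Doob's bound at level `ε m
    -- N` the factor `N²` cancels, leaving `2 s² / (ε² m)`.
    refine ⟨B + 2 * s ^ 2 / ε ^ 2, by positivity, fun m hm κ hκ => ?_⟩
    have hm0 : (0 : ℝ) < m := by positivity
    set N := ⌈b * m / κ⌉₊ + 2 with hN
    have hN0 : (0 : ℝ) < N := by rw [hN]; positivity
    have hNle : (N : ℝ) ≤ b * m / κ + 3 := by
      have := Nat.ceil_lt_add_one (show 0 ≤ b * m / κ by positivity)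
      rw [hN]; push_cast; linarith
    have hNge : C * m * s / κ ≤ N - 1 := by
      have := Nat.le_ceil (b * m / κ)
      have h2 : C * m * s / κ = b * m / κ := by rw [hb]; ring
      rw [hN, h2]; push_cast; linarith
    have hUp := h.measure_errorDev_gt_le hC hκ (m := m) (N := N) (by omega) hNge
    have hD := h.measure_exists_errorMart_le m N (a := ε * (m * N)) (by positivity)
    have hsub : {ω | (1 + θ) * κ * (sInf (stoppingSet δ m κ ω) : ℕ) ^ 2
          < ∑ j ∈ Finset.range m, errorSum δ j (sInf (stoppingSet δ m κ ω)) ω ^ 2} ⊆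
        {ω | κ * (N * (N - 1)) < errorDev δ m N ω} ∪
        ({ω | ∃ n : ℕ, 2 ≤ n ∧ errorDev δ m n ω < (n - 1) * (m * c₀)} ∪
        {ω | ∃ n ≤ N, ε * (m * N) ≤ |errorMart δ m n ω|}) := by
      intro ω hω
      by_contra hnot
      simp only [Set.mem_union, not_or, Set.mem_ofPred_eq, not_lt, not_exists, not_and,
        not_le] at hnot
      obtain ⟨h1, h2, h3⟩ := hnot
      -- Since `N` itself is admissible, the search ends by `N`, within the range of the maximal
      -- inequality.
      have hmemN : N ∈ stoppingSet δ m κ ω := ⟨by omega, h1⟩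
      have hmem := Nat.sInf_mem ⟨N, hmemN⟩
      have hle := Nat.sInf_le hmemN
      rw [Set.mem_ofPred_eq] at hω
      exact absurd hω (not_lt.2 (noise_le_of_good hθ hc₀0 hκ hb0 hmem hNle hε
        (h2 _ hmem.1) (h3 _ hle).le))
    refine (measure_mono hsub).trans ((measure_union_le _ _).trans
      ((add_le_add hUp ((measure_union_le _ _).trans (add_le_add (hL m hm) hD))).trans ?_))
    rw [← ENNReal.ofReal_add (by positivity) (by positivity),
      ← ENNReal.ofReal_add (by positivity) (by positivity)]
    refine ENNReal.ofReal_le_ofReal (le_of_eq ?_)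
    have : 2 * m * N ^ 2 * s ^ 2 / (ε * (m * N)) ^ 2 = 2 * s ^ 2 / ε ^ 2 / m := by
      field_simp
    rw [this]; ring

/-- The search for the number of repetitions succeeds almost surely. -/
theorem ae_stoppingSet_nonempty (h : IsNoise μ δ) (m : ℕ) {κ : ℝ} (hκ : 0 < κ) :
    ∀ᵐ ω ∂μ, (stoppingSet δ m κ ω).Nonempty := by
  rw [ae_iff]
  refine le_antisymm ?_ zero_le
  have hlim : Tendsto (fun n : ℕ => ENNReal.ofReal (1 / ((n : ℝ) + 1))) atTop (𝓝 0) := by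
    rw [← ENNReal.ofReal_zero]
    exact ENNReal.tendsto_ofReal tendsto_one_div_add_atTop_nhds_zero_nat
  refine ge_of_tendsto' hlim fun k => ?_
  -- Failure of the search has probability at most `1 / C` for every `C`.
  set C : ℝ := k + 1 with hC
  have hC0 : 0 < C := by positivity
  set N := ⌈C * m * errorVar μ δ / κ⌉₊ + 2 with hN
  have hNge : C * m * errorVar μ δ / κ ≤ N - 1 := by
    have := Nat.le_ceil (C * m * errorVar μ δ / κ)
    rw [hN]; push_cast; linarith
  refine (measure_mono fun ω hω => ?_).trans
    (h.measure_errorDev_gt_le hC0 hκ (m := m) (N := N) (by omega) hNge)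
  by_contra hnot
  exact hω ⟨N, by omega, not_lt.1 hnot⟩

/-- The averaged error at the data-driven number of repetitions stays below the prescribed level
with probability tending to one. -/
theorem tendsto_measure_noise_gt (h : IsNoise μ δ) {θ : ℝ} (hθ : 0 < θ) {κ : ℕ → ℝ}
    (hκ : ∀ᶠ m in atTop, 0 < κ m) :
    Tendsto (fun m : ℕ => μ {ω | (1 + θ) * κ m * (sInf (stoppingSet δ m (κ m) ω) : ℕ) ^ 2
      < ∑ j ∈ Finset.range m, errorSum δ j (sInf (stoppingSet δ m (κ m) ω)) ω ^ 2})
      atTop (𝓝 0) := by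
  rw [ENNReal.tendsto_nhds_zero]
  intro e he
  obtain ⟨r, hr0, hre⟩ : ∃ r : ℝ, 0 < r ∧ ENNReal.ofReal r ≤ e := by
    rcases eq_or_ne e ⊤ with rfl | htop
    · exact ⟨1, one_pos, le_top⟩
    · exact ⟨e.toReal, ENNReal.toReal_pos he.ne' htop, (ENNReal.ofReal_toReal htop).le⟩
  -- Half of `r` goes to Markov's inequality, the other half to `A / m` for large `m`.
  obtain ⟨A, hA, hbound⟩ := h.measure_noise_gt_le hθ (C := 2 / r) (by positivity)
  have hlim : Tendsto (fun m : ℕ => A / (m : ℝ)) atTop (𝓝 0) :=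
    tendsto_const_div_atTop_nhds_zero_nat A
  filter_upwards [hκ, eventually_ge_atTop 1, hlim.eventually (gt_mem_nhds (half_pos hr0))]
    with m hm hm1 hm2
  refine (hbound m hm1 _ hm).trans ((ENNReal.ofReal_le_ofReal ?_).trans hre)
  rw [one_div_div]
  linarith

end IsNoise

end NoiseBounds

/-! ### From the errors to the back-projected measurement. -/

section Measurements

variable {Ω : Type*} {δ : ℕ → ℕ → Ω → ℝ}

lemma sum_shift_div (δ : ℕ → ℕ → Ω → ℝ) (b : ℝ) (j : ℕ) {n : ℕ} (hn : 1 ≤ n) (ω : Ω) :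
    (∑ i ∈ Finset.range n, (b + δ i j ω)) / n = b + errorSum δ j n ω / n := by
  have hn0 : (n : ℝ) ≠ 0 := by positivity
  rw [Finset.sum_add_distrib, Finset.sum_const, Finset.card_range, nsmul_eq_mul, errorSum]
  field_simp

lemma mul_sampleVar (δ : ℕ → ℕ → Ω → ℝ) (b : ℕ → ℝ) {m n : ℕ} (hm : 1 ≤ m) (hn : 1 ≤ n) (ω : Ω) :
    m * sampleVar (fun i j => b j + δ i j ω) m n = errorDev δ m n ω / (n - 1) := by
  have hm0 : (m : ℝ) ≠ 0 := by positivity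
  rw [sampleVar, mul_div_cancel₀ _ hm0, errorDev, Finset.sum_div]
  refine Finset.sum_congr rfl fun j _ => ?_
  congr 1
  refine Finset.sum_congr rfl fun i _ => ?_
  rw [sum_shift_div δ (b j) j hn ω]
  ring

/-- The exact data are constant along each channel and cancel in the sample variance, so the search
depends on the errors only. -/
lemma admissibleRepetitions_eq (δ : ℕ → ℕ → Ω → ℝ) (b : ℕ → ℝ) {m : ℕ} (hm : 1 ≤ m) {c d : ℝ}
    (hc : 0 < c) (ω : Ω) :
    admissibleRepetitions (fun i j => b j + δ i j ω) m c d
      = stoppingSet δ m ((c * d) ^ 2) ω := by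
  ext n
  refine and_congr_right fun hn => ?_
  have hn2 : (2 : ℝ) ≤ n := by exact_mod_cast hn
  have hn1 : (0 : ℝ) < n - 1 := by linarith
  have hn0 : (0 : ℝ) < n := by linarith
  rw [mul_sampleVar δ b hm (by omega) ω, div_div, div_le_iff₀ (by positivity)]
  have : d ^ 2 * ((n - 1) * (n * c ^ 2)) = (c * d) ^ 2 * (n * (n - 1)) := by ring
  rw [this]

variable {Y : Type*} [NormedAddCommGroup Y] [InnerProductSpace ℝ Y] [CompleteSpace Y]

lemma norm_sampleMean_sub_sq (l : ℕ → Y →L[ℝ] ℝ) (y : Y) (δ : ℕ → ℕ → Ω → ℝ) (m : ℕ) {n : ℕ}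
    (hn : 1 ≤ n) (ω : Ω) :
    ‖sampleMean (fun i j => l j y + δ i j ω) m n - discOp l m y‖ ^ 2
      = (∑ j ∈ Finset.range m, errorSum δ j n ω ^ 2) / n ^ 2 := by
  rw [EuclideanSpace.norm_sq_eq, ← Fin.sum_univ_eq_sum_range (fun j => errorSum δ j n ω ^ 2),
    Finset.sum_div]
  refine Finset.sum_congr rfl fun j _ => ?_
  have h1 : (sampleMean (fun i j => l j y + δ i j ω) m n - discOp l m y) j
      = (∑ i ∈ Finset.range n, (l j y + δ i j ω)) / n - l j y := rfl
  rw [h1, sum_shift_div δ _ _ hn, add_sub_cancel_left, Real.norm_eq_abs, sq_abs, div_pow]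

/-- The back-projected measurement is close to the exact right hand side as soon as the averaged
error at the chosen number of repetitions is below the prescribed level. -/
lemma norm_backProjection_sub_le (l : ℕ → Y →L[ℝ] ℝ) (y : Y) (δ : ℕ → ℕ → Ω → ℝ) {m : ℕ}
    (hm : 1 ≤ m) {c d τ : ℝ} (hτ : 1 < τ) (hc : 0 < c) (hd : 0 < d)
    (hs : ∀ σ : ℝ, IsSingularValue (discOp l m) σ → c ≤ σ)
    (hy : ‖y - pinv (discOp l m) (discOp l m y)‖ ≤ d) {ω : Ω}
    (hne : (stoppingSet δ m ((c * d) ^ 2) ω).Nonempty)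
    (hnoise : ∑ j ∈ Finset.range m, errorSum δ j (sInf (stoppingSet δ m ((c * d) ^ 2) ω)) ω ^ 2
      ≤ (1 + (τ ^ 2 - 1)) * (c * d) ^ 2 * (sInf (stoppingSet δ m ((c * d) ^ 2) ω) : ℕ) ^ 2) :
    ‖backProjection l (fun i j => l j y + δ i j ω) m c d - y‖ ≤ (1 + τ) * d := by
  rw [backProjection, repetitions, admissibleRepetitions_eq δ (fun j => l j y) hm hc ω]
  have hn : 2 ≤ sInf (stoppingSet δ m ((c * d) ^ 2) ω) := (Nat.sInf_mem hne).1
  set n := sInf (stoppingSet δ m ((c * d) ^ 2) ω)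
  have hn0 : (0 : ℝ) < n := by positivity
  set P := discOp l m
  set e := sampleMean (fun i j => l j y + δ i j ω) m n - P y with he
  have he_le : ‖e‖ ≤ τ * (c * d) := by
    refine le_of_sq_le_sq ?_ (by positivity)
    rw [he, norm_sampleMean_sub_sq l y δ m (by omega) ω, div_le_iff₀ (by positivity)]
    linarith
  have hsplit : sampleMean (fun i j => l j y + δ i j ω) m n = P y + e := by rw [he]; abel
  rw [hsplit, pinv_add P hc hs]
  -- Propagated measurement error, at most `τ d`, minus the discretisation error, at most `d`.
  have h1 : pinv P (P y) + pinv P e - y = pinv P e - (y - pinv P (P y)) := by abel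
  rw [h1]
  have h2 : ‖pinv P e‖ ≤ τ * d := by
    refine (norm_pinv_le P hc hs e).trans ?_
    rw [div_le_iff₀ hc]
    linarith
  refine (norm_sub_le _ _).trans ?_
  linarith

end Measurements

end InvProb

/-! ### Assembly of the two halves. -/

open InvProb in
theorem corollary1p2 (τ q : ℝ) (hτ : 1 < τ) (hq0 : 0 < q) (hq1 : q < 1) :
    ∃ L' : ℝ → ℝ,
      ∀ (X : Type*) [NormedAddCommGroup X] [InnerProductSpace ℝ X] [CompleteSpace X]
        (Y : Type*) [NormedAddCommGroup Y] [InnerProductSpace ℝ Y] [CompleteSpace Y]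
        (Ω : Type*) [MeasurableSpace Ω] (μ : Measure Ω) [IsProbabilityMeasure μ]
        -- the forward operator and the exact right hand side
        (K : X →L[ℝ] Y) (_ : IsCompactOperator K) (_ : Function.Injective K) (_ : DenseRange K)
        (y : Y) (_ : y ∈ InvProb.pinvDomain K)
        -- the measurement channels
        (l : ℕ → Y →L[ℝ] ℝ) (_ : ∀ i j, ‖l i‖ = ‖l j‖)
        (_ : InvProb.IsCompleteFamily l) (_ : InvProb.IsWellConditioned l)
        -- the measurement errors
        (δ : ℕ → ℕ → Ω → ℝ) (_ : ∀ i j, Measurable (δ i j))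
        (_ : iIndepFun (fun p : ℕ × ℕ => δ p.1 p.2) μ)
        (_ : ∀ i j, IdentDistrib (δ i j) (δ 0 0) μ μ)
        (_ : ∀ i j, MemLp (δ i j) 2 μ) (_ : ∀ i j, ∫ ω, δ i j ω ∂μ = 0)
        -- the known bounds for the discretisation error and for the singular values
        (d : ℕ → ℝ) (_ : ∀ᶠ m in atTop, 0 < d m)
        (_ : ∀ᶠ m in atTop,
          ‖y - InvProb.pinv (InvProb.discOp l m) (InvProb.discOp l m y)‖ ≤ d m)
        (_ : Tendsto d atTop (𝓝 0))
        (c : ℕ → ℝ) (_ : ∀ᶠ m in atTop, 0 < c m ∧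
          ∀ σ : ℝ, InvProb.IsSingularValue (InvProb.discOp l m) σ → c m ≤ σ),
      (∀ᶠ m in atTop, ∀ᵐ ω ∂μ,
        InvProb.Terminates K l (fun i j => l j y + δ i j ω) m (c m) (d m) τ q) ∧
      (∀ ε : ℝ, 0 < ε →
        Tendsto (fun m : ℕ =>
          μ {ω | ε ≤ ‖InvProb.idrReconstruction K l (fun i j => l j y + δ i j ω) m (c m) (d m) τ q
            - InvProb.pinv K y‖}) atTop (𝓝 0)) ∧
      (∀ ν ρ : ℝ, 0 < ν → ν ≤ 1 → 0 < ρ →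
        (∃ w : X, ‖w‖ ≤ ρ ∧
          InvProb.pinv K y = InvProb.spectralPower (K.adjoint ∘L K) (ν / 2) w) →
        Tendsto (fun m : ℕ =>
          μ {ω | ‖InvProb.idrReconstruction K l (fun i j => l j y + δ i j ω) m (c m) (d m) τ q
            - InvProb.pinv K y‖ ≤ L' ν * ρ ^ (1 / (ν + 1)) * d m ^ (ν / (ν + 1))})
          atTop (𝓝 1)) := by
  refine ⟨rateConstant τ q, ?_⟩
  intro X _ _ _ Y _ _ _ Ω _ μ _ K _ hinj hdense y hy l _ _ _ δ hmeas hind hident hL2 hmean d hd0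
    hdisc hdlim c hc
  have hnoise : IsNoise μ δ := ⟨hmeas, hind, hident, hL2, hmean⟩
  have hτ0 : 0 < τ := zero_lt_one.trans hτ
  -- The tolerance `θ = τ² - 1` satisfies `√(1 + θ) = τ`; it is positive because `τ > 1`.
  have hθ : 0 < τ ^ 2 - 1 := by nlinarith
  have hKx : K (pinv K y) = y := map_pinv_of_denseRange K hinj hdense hy
  set x := pinv K y
  set bad : ℕ → Set Ω := fun m =>
    {ω | (1 + (τ ^ 2 - 1)) * (c m * d m) ^ 2 *
        (sInf (stoppingSet δ m ((c m * d m) ^ 2) ω) : ℕ) ^ 2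
      < ∑ j ∈ Finset.range m,
          errorSum δ j (sInf (stoppingSet δ m ((c m * d m) ^ 2) ω)) ω ^ 2} with hbad
  have hbadlim : Tendsto (fun m => μ (bad m)) atTop (𝓝 0) := by
    refine hnoise.tendsto_measure_noise_gt hθ ?_
    filter_upwards [hd0, hc] with m h1 h2
    have := h2.1
    positivity
  have hclose : ∀ᶠ m in atTop, ∀ᵐ ω ∂μ, ω ∉ bad m →
      ‖backProjection l (fun i j => l j y + δ i j ω) m (c m) (d m) - K x‖ ≤ (1 + τ) * d m := by
    filter_upwards [hd0, hc, hdisc, eventually_ge_atTop 1] with m h1 h2 h3 h4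
    have h5 := h2.1
    filter_upwards [hnoise.ae_stoppingSet_nonempty m (κ := (c m * d m) ^ 2) (by positivity)]
      with ω hω hgood
    rw [hKx]
    rw [hbad, Set.mem_ofPred_eq, not_lt] at hgood
    exact norm_backProjection_sub_le l y δ h4 hτ h5 h1 h2.2 h3 hω hgood
  refine ⟨?_, ?_, ?_⟩
  · filter_upwards [hd0, hc, eventually_ge_atTop 1] with m h1 h2 h4
    have h5 := h2.1
    filter_upwards [hnoise.ae_stoppingSet_nonempty m (κ := (c m * d m) ^ 2) (by positivity)]
      with ω hω
    refine ⟨?_, admissibleIndices_nonempty K hdense _ hq0 hq1 hτ0 h1⟩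
    rwa [admissibleRepetitions_eq δ (fun j => l j y) h4 h5 ω]
  · intro ε hε
    obtain ⟨d₀, hd₀, hconv⟩ := tikhonov_discrepancy_convergence K hinj hdense hτ hq0 hq1 x hε
    refine tendsto_of_tendsto_of_tendsto_of_le_of_le' tendsto_const_nhds hbadlim
      (Eventually.of_forall fun _ => zero_le) ?_
    filter_upwards [hd0, hclose, hdlim.eventually (gt_mem_nhds hd₀)] with m h1 h2 h3
    refine measure_mono_ae ?_
    filter_upwards [h2] with ω hω hmem
    by_contra hgood
    exact absurd (hconv (d m) h1 h3 _ (hω hgood)) (not_lt.2 hmem)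
  · rintro ν ρ hν hν1 hρ ⟨w, hw, hxw⟩
    have hlim : Tendsto (fun m => 1 - μ (bad m)) atTop (𝓝 1) := by
      have := ENNReal.Tendsto.sub (tendsto_const_nhds (x := (1 : ℝ≥0∞)) (f := atTop)) hbadlim
        (Or.inl ENNReal.one_ne_top)
      rwa [tsub_zero] at this
    refine tendsto_of_tendsto_of_tendsto_of_le_of_le' hlim tendsto_const_nhds ?_
      (Eventually.of_forall fun _ => prob_le_one)
    -- Since `d m → 0`, eventually `d m ≤ ρ`, as the rate estimate requires.
    filter_upwards [hd0, hclose, hdlim.eventually (gt_mem_nhds hρ)] with m h1 h2 h3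
    -- Covering the whole space by the event and `bad m` uses subadditivity only, so measurability
    -- of neither set is needed.
    rw [tsub_le_iff_right, ← measure_univ (μ := μ)]
    refine le_trans (measure_mono_ae ?_) (measure_union_le _ _)
    filter_upwards [h2] with ω hω _
    by_cases hgood : ω ∈ bad m
    · exact Or.inr hgood
    · refine Or.inl (tikhonov_discrepancy_rate K hdense hτ hq0 hq1 h1 hν hρ h3.le ?_ ?_ (hω hgood))
      · intro β hβ
        rw [hxw]
        exact norm_map_approxError_spectralPower_le K hβ hν hν1 hw
      · intro β hβ t ht
        rw [hxw]
        exact norm_sq_approxError_spectralPower_le K hβ hν ht hw
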